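/- Let $d\ge 3$ and let $X_n$, $n=0,1,\dots$, be a random walk on $\mathbb Z^d$ with $X_0=0$ (i.i.d. increments). For $A\subseteq\mathbb Z^d$ put $\mu^X_n(A)=\sum_{j=0}^n \mathbf 1_A(X_j)$. Let $\gamma_d=\mathbf P(X_s\neq 0\text{ for all } s\ge 1)$ be the probability of no return to the origin and, for $y\in\mathbb Z^d$, let $t_y=\mathbf P(X_s=y\text{ for some } s\ge 1)$. Let $e_1,\dots,e_d$ be the standard unit vectors, $S(0,1)=\{\pm e_1,\dots,\pm e_d\}$ and $B(0,1)=\{0\}\cup S(0,1)$. (a) Suppose that the walk is symmetric ($X_1$ and $-X_1$ have the same law), transient, not supported on any proper subgroup of $\mathbb Z^d$, and has finite second moments. Then for every $0\neq y\in\mathbb Z^d$, almost surely, $$\lim_{n\to\infty}\sup_{x\in\mathbb Z^d}\frac{\mu^X_n(x+\{0,y\})}{\log n}=\frac{-1}{\log\left(1-\frac{\gamma_d}{1+t_y}\right)}.$$ (b) Suppose that $X$ is the simple random walk, i.e. $\mathbf P(X_1=\pm e_i)=\frac1{2d}$ for each $i$ and each sign. Then, almost surely, $$\lim_{n\to\infty}\sup_{x\in\mathbb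 Z^d}\frac{\mu^X_n(x+S(0,1))}{\log n}=\frac{-1}{\log\left(1-\frac{\gamma_d}{2d(1-\gamma_d)}\right)}$$ and, almost surely, $$\lim_{n\to\infty}\sup_{x\in\mathbb Z^d}\frac{\mu^X_n(x+B(0,1))}{\log n}=\frac{-1}{\log\left(\frac{p+\sqrt{p^2+2/d}}{2}\right)},\qquad p=1-\frac{1}{2d(1-\gamma_d)}.$$ -/

import Mathlib

open MeasureTheory ProbabilityTheory Filter Topology

namespace LatticeWalk

variable {d : ℕ} {Ω : Type*} [MeasurableSpace Ω]

/-- `X` is a random walk on `ℤ^d` started at the origin: its increments are independent and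
identically distributed. -/
structure IsRandomWalk (X : ℕ → Ω → (Fin d → ℤ)) (P : Measure Ω) : Prop where
  measurable : ∀ n, Measurable (X n)
  start : ∀ᵐ ω ∂P, X 0 ω = 0
  indep : iIndepFun (fun n ω => X (n + 1) ω - X n ω) P
  ident : ∀ n, IdentDistrib (fun ω => X (n + 1) ω - X n ω) (X 1) P P

/-- The step distribution is symmetric. -/
def IsSymmetric (X : ℕ → Ω → (Fin d → ℤ)) (P : Measure Ω) : Prop :=
  IdentDistrib (X 1) (fun ω => -X 1 ω) P P

/-- The walk is not supported on any proper subgroup of `ℤ^d`. -/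
def IsFull (X : ℕ → Ω → (Fin d → ℤ)) (P : Measure Ω) : Prop :=
  ∀ H : AddSubgroup (Fin d → ℤ), (∀ n, ∀ᵐ ω ∂P, X n ω ∈ H) → H = ⊤

/-- The steps have finite second moments. -/
def HasSecondMoments (X : ℕ → Ω → (Fin d → ℤ)) (P : Measure Ω) : Prop :=
  ∀ i, MemLp (fun ω => (X 1 ω i : ℝ)) 2 P

/-- `t_y`, the probability that the walk is at `y` at some time `s > 0`. -/
noncomputable def hitProb (X : ℕ → Ω → (Fin d → ℤ)) (P : Measure Ω) (y : Fin d → ℤ) : ℝ :=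
  P.real {ω | ∃ s, 0 < s ∧ X s ω = y}

/-- `γ_d`, the probability that the walk never returns to the origin. -/
noncomputable def noReturnProb (X : ℕ → Ω → (Fin d → ℤ)) (P : Measure Ω) : ℝ :=
  P.real {ω | ∀ s, 0 < s → X s ω ≠ 0}

/-- The walk is transient: with positive probability it never returns to the origin. -/
def IsTransient (X : ℕ → Ω → (Fin d → ℤ)) (P : Measure Ω) : Prop :=
  0 < noReturnProb X P

/-- The Euclidean unit sphere `S(0,1) = {e_1, …, e_d, -e_1, …, -e_d}` in `ℤ^d`. -/
def unitSphere (d : ℕ) : Set (Fin d → ℤ) :=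
  {x | ∃ i, x = Pi.single i 1 ∨ x = -Pi.single i 1}

/-- The Euclidean unit ball `B(0,1) = {0} ∪ S(0,1)` in `ℤ^d`. -/
def unitBall (d : ℕ) : Set (Fin d → ℤ) :=
  insert 0 (unitSphere d)

/-- The steps are those of the simple random walk: uniform on the `2d` unit vectors. -/
def IsSimple (X : ℕ → Ω → (Fin d → ℤ)) (P : Measure Ω) : Prop :=
  ∀ x ∈ unitSphere d, P.real {ω | X 1 ω = x} = 1 / (2 * (d : ℝ))

/-- The occupation measure `μ_n(A) = ∑_{j=0}^n 1_A(X_j)` of a path `x`. -/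
noncomputable def occupation (x : ℕ → (Fin d → ℤ)) (n : ℕ) (A : Set (Fin d → ℤ)) : ℝ :=
  ∑ j ∈ Finset.range (n + 1), A.indicator 1 (x j)

/-- `sup_{z ∈ ℤ^d} μ_n(z + A) / log n`. For `n ≥ 2` the family is bounded by `(n + 1) / log n`. -/
noncomputable def maxOccupationRatio (x : ℕ → (Fin d → ℤ)) (A : Set (Fin d → ℤ)) (n : ℕ) : ℝ :=
  ⨆ z : Fin d → ℤ, occupation x n ((fun a => z + a) '' A) / Real.log n

end LatticeWalk

open LatticeWalk

/-! Watch the walk only at its visits to a finite set `A`. Transience makes this a sub-stochastic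
chain on `A`; if `r` is its principal eigenvalue, the probability of at least `k + 1` visits decays
like `r ^ k`. A walk of length `n` gives about `n` attempts, so the best translate of `A` collects
about `k` visits with `n * r ^ k` of order one, that is `k ≈ -log n / log r`.

The eigenvalue is exhibited by a bounded nonnegative `φ`, positive on `A`, harmonic off `A`,
multiplied by `r` under one step from `A`, and equal to the expectation of its value at the first
visit to `A` (its killed iterates vanish). Comparing the recursion for visit counts with `r ^ k * φ`
gives the upper tail (`visitTail_le_of_supersolution`); allowing only a bounded time for each return
gives the lower tail at any rate `s < r` (`le_visitTail_of_subsolution`).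
`IsRandomWalk.tendsto_maxOccupationRatio` combines them: a union bound over first visit times from
above, independent time blocks from below, Borel–Cantelli along `n = 2 ^ l`, and interpolation.

It remains to find `φ`. Let `h` be the probability of ever hitting `0`. For `{0, y}` symmetry allows
`h x + h (x - y)`. For the simple walk all neighbours of `0` share the value `u = 1 - γ` of `h`, and
the eigenfunction is a multiple of `h` with its value at `0` reset to `1`: the multiple is `1 / u`
for the sphere and `r / u` for the ball, where the eigenvalue equation becomes quadratic. Transience
of the simple walk, needed for `r < 1`, comes from an explicit superharmonic function. -/

namespace LatticeWalk

/-! ### Visit-count tails and killed iterates of the transition operator. -/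

section Kernel

set_option linter.unusedSectionVars false

variable {E : Type*} [AddCommGroup E] [MeasurableSpace E] [DiscreteMeasurableSpace E]
  (ν : Measure E) [IsProbabilityMeasure ν]

/-- The transition operator of the walk with step law `ν`. -/
noncomputable def transition (f : E → ℝ) (x : E) : ℝ := ∫ z, f (x + z) ∂ν

/-- The probability that the walk from `x` makes at least `k` visits to `A` up to time `n`,
defined by conditioning on the first step. -/
noncomputable def visitTail (A : Set E) : ℕ → E → ℕ → ℝ
  | 0, x, k => if k ≤ A.indicator (fun _ => 1) x then 1 else 0
  -- The subtraction is truncated: once `k` visits have occurred the remaining demand stays `0`.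
  | n + 1, x, k => ∫ z, visitTail A n (x + z) (k - A.indicator (fun _ => 1) x) ∂ν

/-- `killedIterate ν A f m x` is the expectation of `f (X m)` for the walk from `x`, on the event
that `A` is not visited up to time `m`. -/
noncomputable def killedIterate (A : Set E) (f : E → ℝ) : ℕ → E → ℝ
  | 0 => Aᶜ.indicator f
  | m + 1 => Aᶜ.indicator (transition ν (killedIterate A f m))

variable {ν}

theorem integrable_of_bounds {f : E → ℝ} {C : ℝ} (h0 : ∀ x, 0 ≤ f x) (hC : ∀ x, f x ≤ C) (x : E) :
    Integrable (fun z => f (x + z)) ν :=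
  Integrable.of_bound (C := C) Measurable.of_discrete.aestronglyMeasurable
    (Eventually.of_forall fun z => by
      rw [Real.norm_eq_abs, abs_of_nonneg (h0 _)]; exact hC _)

theorem transition_nonneg {f : E → ℝ} (h0 : ∀ x, 0 ≤ f x) (x : E) : 0 ≤ transition ν f x :=
  integral_nonneg fun _ => h0 _

theorem transition_mono {f g : E → ℝ} {C : ℝ} (h0 : ∀ x, 0 ≤ f x) (hfg : ∀ x, f x ≤ g x)
    (hC : ∀ x, g x ≤ C) (x : E) : transition ν f x ≤ transition ν g x :=
  integral_mono (integrable_of_bounds h0 (fun y => (hfg y).trans (hC y)) x)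
    (integrable_of_bounds (fun y => (h0 y).trans (hfg y)) hC x) fun _ => hfg _

theorem transition_const (c : ℝ) (x : E) : transition ν (fun _ => c) x = c := by
  simp [transition]

theorem transition_const_mul (c : ℝ) (f : E → ℝ) (x : E) :
    transition ν (fun y => c * f y) x = c * transition ν f x := by
  simp [transition, integral_const_mul]

theorem transition_le {f : E → ℝ} {C : ℝ} (h0 : ∀ x, 0 ≤ f x) (hC : ∀ x, f x ≤ C) (x : E) :
    transition ν f x ≤ C :=
  (transition_mono h0 hC (fun _ => le_rfl) x).trans_eq (transition_const C x)

theorem tendsto_transition {f : ℕ → E → ℝ} {g : E → ℝ} {C : ℝ} (h0 : ∀ m x, 0 ≤ f m x)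
    (hC : ∀ m x, f m x ≤ C) (hf : ∀ x, Tendsto (fun m => f m x) atTop (𝓝 (g x))) (x : E) :
    Tendsto (fun m => transition ν (f m) x) atTop (𝓝 (transition ν g x)) := by
  refine tendsto_integral_of_dominated_convergence (fun _ => C)
    (fun m => Measurable.of_discrete.aestronglyMeasurable) (integrable_const C)
    (fun m => Eventually.of_forall fun z => ?_) (Eventually.of_forall fun z => hf _)
  rw [Real.norm_eq_abs, abs_of_nonneg (h0 _ _)]
  exact hC _ _

variable {A : Set E}

theorem visitTail_nonneg (n : ℕ) (x : E) (k : ℕ) : 0 ≤ visitTail ν A n x k := by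
  induction n generalizing x k with
  | zero => rw [visitTail]; split_ifs <;> norm_num
  | succ n ih => rw [visitTail]; exact integral_nonneg fun _ => ih _ _

theorem visitTail_le_one (n : ℕ) (x : E) (k : ℕ) : visitTail ν A n x k ≤ 1 := by
  induction n generalizing x k with
  | zero => rw [visitTail]; split_ifs <;> norm_num
  | succ n ih => exact transition_le (fun y => visitTail_nonneg n y _) (fun y => ih y _) x

theorem visitTail_zero (n : ℕ) (x : E) : visitTail ν A n x 0 = 1 := by
  induction n generalizing x with
  | zero => simp [visitTail]
  | succ n ih => simp [visitTail, ih]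

theorem visitTail_succ_of_mem {x : E} (hx : x ∈ A) (n k : ℕ) :
    visitTail ν A (n + 1) x (k + 1) = transition ν (fun y => visitTail ν A n y k) x := by
  simp [visitTail, transition, hx]

theorem visitTail_succ_of_notMem {x : E} (hx : x ∉ A) (n k : ℕ) :
    visitTail ν A (n + 1) x k = transition ν (fun y => visitTail ν A n y k) x := by
  simp [visitTail, transition, hx]

theorem visitTail_one_of_mem {x : E} (hx : x ∈ A) (n : ℕ) : visitTail ν A n x 1 = 1 := by
  cases n with
  | zero => simp [visitTail, hx]
  | succ n => simp [visitTail, hx, visitTail_zero]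

theorem visitTail_mono (x : E) (k : ℕ) : Monotone fun n => visitTail ν A n x k := by
  refine monotone_nat_of_le_succ fun n => ?_
  induction n generalizing x k with
  | zero =>
    rw [visitTail]
    split_ifs with h
    · rw [visitTail, Nat.sub_eq_zero_of_le h]; simp [visitTail_zero]
    · exact visitTail_nonneg _ _ _
  | succ n ih =>
    exact transition_mono (fun y => visitTail_nonneg n y _) (fun y => ih y _)
      (fun y => visitTail_le_one _ y _) x

/-- The right-hand side is a supersolution of the recursion defining `visitTail`: every visit after
the first costs a factor `r`, and `c⁻¹ * φ` is at least `1` where the first visit takes place. -/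
theorem visitTail_le_of_supersolution {φ : E → ℝ} {C c r : ℝ} (h0 : ∀ x, 0 ≤ φ x)
    (hC : ∀ x, φ x ≤ C) (hc : 0 < c) (hr : 0 ≤ r) (hcA : ∀ x ∈ A, c ≤ φ x)
    (hoff : ∀ x ∉ A, transition ν φ x ≤ φ x) (hon : ∀ x ∈ A, transition ν φ x ≤ r * φ x)
    (n : ℕ) (x : E) (k : ℕ) : visitTail ν A n x (k + 1) ≤ c⁻¹ * r ^ k * φ x := by
  have hmul : ∀ k x, 0 ≤ c⁻¹ * r ^ k * φ x := fun k x => by have := h0 x; positivity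
  have one_le : ∀ x ∈ A, 1 ≤ c⁻¹ * r ^ 0 * φ x := fun x hx => by
    rw [pow_zero, mul_one, inv_mul_eq_div, one_le_div hc]; exact hcA x hx
  have bound : ∀ (n k : ℕ), (∀ y, visitTail ν A n y (k + 1) ≤ c⁻¹ * r ^ k * φ y) → ∀ x,
      transition ν (fun y => visitTail ν A n y (k + 1)) x ≤ c⁻¹ * r ^ k * transition ν φ x := by
    intro n k h x
    rw [← transition_const_mul]
    exact transition_mono (C := c⁻¹ * r ^ k * C) (fun y => visitTail_nonneg n y _) h
      (fun y => mul_le_mul_of_nonneg_left (hC y) (by positivity)) x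
  induction n generalizing x k with
  | zero =>
    by_cases hx : x ∈ A
    · cases k with
      | zero => exact (visitTail_le_one _ _ _).trans (one_le x hx)
      | succ k => simpa [visitTail, hx] using hmul (k + 1) x
    · simpa [visitTail, hx] using hmul k x
  | succ n ih =>
    by_cases hx : x ∈ A
    · cases k with
      | zero => exact (visitTail_le_one _ _ _).trans (one_le x hx)
      | succ k =>
        rw [visitTail_succ_of_mem hx]
        refine (bound n k (fun y => ih y k) x).trans ?_
        calc c⁻¹ * r ^ k * transition ν φ x ≤ c⁻¹ * r ^ k * (r * φ x) :=
              mul_le_mul_of_nonneg_left (hon x hx) (by positivity)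
          _ = c⁻¹ * r ^ (k + 1) * φ x := by ring
    · rw [visitTail_succ_of_notMem hx]
      exact (bound n k (fun y => ih y k) x).trans
        (mul_le_mul_of_nonneg_left (hoff x hx) (by positivity))

theorem killedIterate_nonneg {f : E → ℝ} (h0 : ∀ x, 0 ≤ f x) (m : ℕ) (x : E) :
    0 ≤ killedIterate ν A f m x := by
  induction m generalizing x with
  | zero => exact Set.indicator_nonneg (fun _ _ => h0 _) x
  | succ m ih => exact Set.indicator_nonneg (fun _ _ => transition_nonneg ih _) x

theorem killedIterate_of_mem {x : E} (hx : x ∈ A) (f : E → ℝ) (m : ℕ) :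
    killedIterate ν A f m x = 0 := by
  cases m <;> simp [killedIterate, hx]

theorem killedIterate_succ_of_notMem {x : E} (hx : x ∉ A) (f : E → ℝ) (m : ℕ) :
    killedIterate ν A f (m + 1) x = transition ν (killedIterate ν A f m) x := by
  simp [killedIterate, hx]

theorem killedIterate_zero_of_notMem {x : E} (hx : x ∉ A) (f : E → ℝ) :
    killedIterate ν A f 0 x = f x := by
  simp [killedIterate, hx]

theorem killedIterate_le {φ : E → ℝ} {C : ℝ} (h0 : ∀ x, 0 ≤ φ x) (hC : ∀ x, φ x ≤ C)
    (hoff : ∀ x ∉ A, transition ν φ x = φ x) (m : ℕ) (x : E) :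
    killedIterate ν A φ m x ≤ φ x := by
  induction m generalizing x with
  | zero => exact Set.indicator_le_self' (fun _ _ => h0 _) x
  | succ m ih =>
    by_cases hx : x ∈ A
    · rw [killedIterate_of_mem hx]; exact h0 x
    · rw [killedIterate_succ_of_notMem hx, ← hoff x hx]
      exact transition_mono (killedIterate_nonneg h0 m) ih hC x

/-- Enlarging the killing set and decreasing the function decreases the killed expectation. -/
theorem killedIterate_mono {A' : Set E} {f g : E → ℝ} {C : ℝ} (hA : A ⊆ A')
    (h0 : ∀ x, 0 ≤ f x) (hfg : ∀ x, f x ≤ g x) (hC : ∀ x, g x ≤ C)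
    (hg : ∀ x ∉ A, transition ν g x = g x) (m : ℕ) (x : E) :
    killedIterate ν A' f m x ≤ killedIterate ν A g m x := by
  have hg0 : ∀ x, 0 ≤ g x := fun x => (h0 x).trans (hfg x)
  induction m generalizing x with
  | zero =>
    by_cases hx : x ∈ A'
    · rw [killedIterate_of_mem hx]; exact killedIterate_nonneg hg0 _ _
    · rw [killedIterate_zero_of_notMem hx, killedIterate_zero_of_notMem fun h => hx (hA h)]
      exact hfg x
  | succ m ih =>
    by_cases hx : x ∈ A'
    · rw [killedIterate_of_mem hx]; exact killedIterate_nonneg hg0 _ _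
    · rw [killedIterate_succ_of_notMem hx, killedIterate_succ_of_notMem fun h => hx (hA h)]
      exact transition_mono (killedIterate_nonneg h0 m) ih
        (fun y => (killedIterate_le hg0 hC hg m y).trans (hC y)) x

theorem transition_sub {f g : E → ℝ} {C : ℝ} (hf0 : ∀ x, 0 ≤ f x) (hf : ∀ x, f x ≤ C)
    (hg0 : ∀ x, 0 ≤ g x) (hg : ∀ x, g x ≤ C) (x : E) :
    transition ν (fun y => f y - g y) x = transition ν f x - transition ν g x :=
  integral_sub (integrable_of_bounds hf0 hf x) (integrable_of_bounds hg0 hg x)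

theorem transition_add {f g : E → ℝ} {C : ℝ} (hf0 : ∀ x, 0 ≤ f x) (hf : ∀ x, f x ≤ C)
    (hg0 : ∀ x, 0 ≤ g x) (hg : ∀ x, g x ≤ C) (x : E) :
    transition ν (fun y => f y + g y) x = transition ν f x + transition ν g x :=
  integral_add (integrable_of_bounds hf0 hf x) (integrable_of_bounds hg0 hg x)

theorem killedIterate_const_mul (c : ℝ) (f : E → ℝ) (m : ℕ) (x : E) :
    killedIterate ν A (fun y => c * f y) m x = c * killedIterate ν A f m x := by
  induction m generalizing x with
  | zero => by_cases hx : x ∈ A <;> simp [killedIterate, hx]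
  | succ m ih =>
    by_cases hx : x ∈ A
    · simp [killedIterate, hx]
    · rw [killedIterate_succ_of_notMem hx, killedIterate_succ_of_notMem hx, funext ih,
        transition_const_mul]

theorem killedIterate_add {f g : E → ℝ} {C : ℝ} (hf0 : ∀ x, 0 ≤ f x) (hf : ∀ x, f x ≤ C)
    (hg0 : ∀ x, 0 ≤ g x) (hg : ∀ x, g x ≤ C) (m : ℕ) (x : E) :
    killedIterate ν A (fun y => f y + g y) m x =
      killedIterate ν A f m x + killedIterate ν A g m x := by
  have le : ∀ (f : E → ℝ), (∀ x, 0 ≤ f x) → (∀ x, f x ≤ C) → ∀ m x,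
      killedIterate ν A f m x ≤ C := by
    intro f h0 hC m
    have hC0 : ∀ x : E, 0 ≤ C := fun x => (h0 x).trans (hC x)
    induction m with
    | zero => intro x; by_cases hx : x ∈ A <;> simp [killedIterate, hx, hC, hC0 x]
    | succ m ih =>
      intro x
      by_cases hx : x ∈ A
      · rw [killedIterate_of_mem hx]; exact hC0 x
      · rw [killedIterate_succ_of_notMem hx]
        exact transition_le (killedIterate_nonneg h0 m) ih x
  induction m generalizing x with
  | zero => by_cases hx : x ∈ A <;> simp [killedIterate, hx]
  | succ m ih =>
    by_cases hx : x ∈ A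
    · simp [killedIterate, hx]
    · simp only [killedIterate_succ_of_notMem hx]
      rw [funext ih, transition_add (killedIterate_nonneg hf0 m) (le f hf0 hf m)
        (killedIterate_nonneg hg0 m) (le g hg0 hg m)]

/-- When `φ` is harmonic off `A`, `φ - killedIterate ν A φ m` is the expectation of `φ` at the first
visit to `A`, restricted to that visit occurring by time `m`. Hence `hon` says that returns within
`m + 1` steps alone already give the factor `r`, and `k` further visits fit into time `(m + 1) * k`.
-/
theorem le_visitTail_of_subsolution {φ : E → ℝ} {C r : ℝ} (h0 : ∀ x, 0 ≤ φ x)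
    (hC : ∀ x, φ x ≤ C) (hC0 : 0 < C) (hr : 0 ≤ r) (hoff : ∀ x ∉ A, transition ν φ x = φ x)
    {m : ℕ} (hon : ∀ x ∈ A,
      r * φ x ≤ transition ν (fun y => φ y - killedIterate ν A φ m y) x)
    {x : E} (hx : x ∈ A) (k : ℕ) :
    C⁻¹ * r ^ k * φ x ≤ visitTail ν A ((m + 1) * k) x (k + 1) := by
  set κ := fun j y => φ y - killedIterate ν A φ j y with hκ
  have κ0 : ∀ j y, 0 ≤ κ j y := fun j y => sub_nonneg.2 (killedIterate_le h0 hC hoff j y)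
  have κC : ∀ j y, κ j y ≤ C := fun j y =>
    (sub_le_self _ (killedIterate_nonneg h0 j y)).trans (hC y)
  have κA : ∀ j, ∀ y ∈ A, κ j y = φ y := fun j y hy => by
    simp [hκ, killedIterate_of_mem hy]
  have bound : ∀ (k n j : ℕ), (∀ y, C⁻¹ * r ^ k * κ j y ≤ visitTail ν A n y (k + 1)) → ∀ x,
      C⁻¹ * r ^ k * transition ν (κ j) x ≤
        transition ν (fun y => visitTail ν A n y (k + 1)) x := by
    intro k n j h x
    rw [← transition_const_mul]
    exact transition_mono (fun y => mul_nonneg (by positivity) (κ0 j y)) h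
      (fun y => visitTail_le_one n y _) x
  -- The extra time `j` is the window allowed for reaching `A` for the first time; the outer
  -- induction counts visits, the inner one this window.
  have main : ∀ k j x, C⁻¹ * r ^ k * κ j x ≤ visitTail ν A ((m + 1) * k + j) x (k + 1) := by
    intro k
    induction k with
    | zero =>
      intro j
      induction j with
      | zero =>
        intro x
        by_cases hx : x ∈ A
        · rw [visitTail_one_of_mem hx, pow_zero, mul_one, inv_mul_eq_div, div_le_one hC0]
          exact κC _ _
        · simpa [hκ, killedIterate_zero_of_notMem hx] using visitTail_nonneg _ _ _
      | succ j ih =>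
        intro x
        by_cases hx : x ∈ A
        · rw [visitTail_one_of_mem hx, pow_zero, mul_one, inv_mul_eq_div, div_le_one hC0]
          exact κC _ _
        · rw [← add_assoc, visitTail_succ_of_notMem hx]
          refine le_trans (le_of_eq ?_) (bound 0 _ j ih x)
          simp only [hκ]
          rw [transition_sub h0 hC (killedIterate_nonneg h0 j)
            (fun y => (killedIterate_le h0 hC hoff j y).trans (hC y)), hoff x hx,
            killedIterate_succ_of_notMem hx]
    | succ k ihk =>
      have onA : ∀ j, ∀ x ∈ A,
          C⁻¹ * r ^ (k + 1) * κ j x ≤ visitTail ν A ((m + 1) * (k + 1) + j) x (k + 1 + 1) := by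
        intro j x hx
        -- From a point of `A` one step is spent leaving and a fresh window of length `m` is opened;
        -- the unused `j` is absorbed by monotonicity in time.
        rw [show (m + 1) * (k + 1) + j = (m + 1) * k + m + j + 1 by ring,
          visitTail_succ_of_mem hx]
        calc C⁻¹ * r ^ (k + 1) * κ j x = C⁻¹ * r ^ k * (r * φ x) := by rw [κA j x hx]; ring
          _ ≤ C⁻¹ * r ^ k * transition ν (κ m) x :=
            mul_le_mul_of_nonneg_left (hon x hx) (by positivity)
          _ ≤ _ := bound k _ m (fun y => (ihk m y).trans
            (visitTail_mono y _ (Nat.le_add_right _ j))) x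
      intro j
      induction j with
      | zero =>
        intro x
        by_cases hx : x ∈ A
        · exact onA 0 x hx
        · simpa [hκ, killedIterate_zero_of_notMem hx] using visitTail_nonneg _ _ _
      | succ j ih =>
        intro x
        by_cases hx : x ∈ A
        · exact onA _ x hx
        · rw [← add_assoc, visitTail_succ_of_notMem hx]
          refine le_trans (le_of_eq ?_) (bound (k + 1) _ j ih x)
          simp only [hκ]
          rw [transition_sub h0 hC (killedIterate_nonneg h0 j)
            (fun y => (killedIterate_le h0 hC hoff j y).trans (hC y)), hoff x hx,
            killedIterate_succ_of_notMem hx]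
  simpa [κA 0 x hx] using main k 0 x

end Kernel

/-! ### Hitting probabilities of a point and the potential of a pair. -/

section Hitting

set_option linter.unusedSectionVars false

variable {E : Type*} [AddCommGroup E] [MeasurableSpace E] [DiscreteMeasurableSpace E]
  (ν : Measure E) [IsProbabilityMeasure ν]

/-- The probability that the walk from `x` with step law `ν` ever visits the origin. -/
noncomputable def hitting (x : E) : ℝ := ⨆ m, visitTail ν {0} m x 1

variable {ν}

theorem tendsto_hitting (x : E) :
    Tendsto (fun m => visitTail ν {0} m x 1) atTop (𝓝 (hitting ν x)) :=
  tendsto_atTop_ciSup (visitTail_mono x 1)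
    ⟨1, by rintro _ ⟨m, rfl⟩; exact visitTail_le_one m x 1⟩

theorem hitting_nonneg (x : E) : 0 ≤ hitting ν x :=
  ge_of_tendsto' (tendsto_hitting x) fun m => visitTail_nonneg m x 1

theorem hitting_le_one (x : E) : hitting ν x ≤ 1 :=
  le_of_tendsto' (tendsto_hitting x) fun m => visitTail_le_one m x 1

theorem hitting_zero : hitting ν (0 : E) = 1 := by
  simp [hitting, visitTail_one_of_mem (Set.mem_singleton (0 : E))]

theorem tendsto_transition_hitting (x : E) :
    Tendsto (fun m => transition ν (fun y => visitTail ν {0} m y 1) x) atTop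
      (𝓝 (transition ν (hitting ν) x)) :=
  tendsto_transition (fun m y => visitTail_nonneg m y 1) (fun m y => visitTail_le_one m y 1)
    tendsto_hitting x

theorem transition_hitting {x : E} (hx : x ≠ 0) :
    transition ν (hitting ν) x = hitting ν x := by
  refine tendsto_nhds_unique (tendsto_transition_hitting x) ?_
  refine ((tendsto_add_atTop_iff_nat 1).2 (tendsto_hitting x)).congr fun m => ?_
  exact visitTail_succ_of_notMem (by simpa using hx) m 1

/-- Both sides are the probability that the first visit to `0` occurs after time `m`. This is why
the killed iterates of `hitting` vanish in the limit. -/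
theorem killedIterate_hitting (m : ℕ) (x : E) :
    killedIterate ν {0} (hitting ν) m x = hitting ν x - visitTail ν {0} m x 1 := by
  induction m generalizing x with
  | zero =>
    by_cases hx : x ∈ ({0} : Set E)
    · rw [killedIterate_of_mem hx, visitTail_one_of_mem hx, Set.mem_singleton_iff.1 hx,
        hitting_zero, sub_self]
    · rw [killedIterate_zero_of_notMem hx]; simp [visitTail, Set.indicator_of_notMem hx]
  | succ m ih =>
    by_cases hx : x ∈ ({0} : Set E)
    · rw [killedIterate_of_mem hx, visitTail_one_of_mem hx, Set.mem_singleton_iff.1 hx,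
        hitting_zero, sub_self]
    · rw [killedIterate_succ_of_notMem hx, funext ih, visitTail_succ_of_notMem hx,
        transition_sub hitting_nonneg hitting_le_one (fun y => visitTail_nonneg m y 1)
          (fun y => visitTail_le_one m y 1), transition_hitting hx]

theorem tendsto_killedIterate_hitting (x : E) :
    Tendsto (fun m => killedIterate ν {0} (hitting ν) m x) atTop (𝓝 0) := by
  simpa [killedIterate_hitting] using (tendsto_hitting (ν := ν) x).const_sub (hitting ν x)

theorem transition_comp_sub_right (f : E → ℝ) (y x : E) :
    transition ν (fun z => f (z - y)) x = transition ν f (x - y) := by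
  simp only [transition, sub_add_eq_add_sub]

theorem killedIterate_comp_sub_right (f : E → ℝ) (y : E) (m : ℕ) (x : E) :
    killedIterate ν {y} (fun z => f (z - y)) m x = killedIterate ν {0} f m (x - y) := by
  have key : ∀ x, x ∉ ({y} : Set E) → x - y ∉ ({0} : Set E) := fun x hx h =>
    hx (sub_eq_zero.1 h)
  induction m generalizing x with
  | zero =>
    by_cases hx : x ∈ ({y} : Set E)
    · rw [killedIterate_of_mem hx, killedIterate_of_mem (A := {0}) (by simpa [sub_eq_zero] using hx)]
    · rw [killedIterate_zero_of_notMem hx, killedIterate_zero_of_notMem (key x hx)]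
  | succ m ih =>
    by_cases hx : x ∈ ({y} : Set E)
    · rw [killedIterate_of_mem hx, killedIterate_of_mem (A := {0}) (by simpa [sub_eq_zero] using hx)]
    · rw [killedIterate_succ_of_notMem hx, killedIterate_succ_of_notMem (key x hx), funext ih,
        transition_comp_sub_right]

/-- A symmetry of the transition operator that sends only `0` to `0` preserves every visit
probability of `0`. -/
theorem hitting_comp {σ : E → E} (h0 : ∀ x, σ x = 0 ↔ x = 0)
    (hσ : ∀ f x, transition ν f (σ x) = transition ν (fun y => f (σ y)) x) (x : E) :
    hitting ν (σ x) = hitting ν x := by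
  have key : ∀ n x, visitTail ν {0} n (σ x) 1 = visitTail ν {0} n x 1 := by
    intro n
    induction n with
    | zero => intro x; by_cases hx : x = 0 <;> simp [visitTail, hx, h0]
    | succ n ih =>
      intro x
      by_cases hx : x ∈ ({0} : Set E)
      · rw [visitTail_one_of_mem hx, 
          visitTail_one_of_mem (show σ x ∈ ({0} : Set E) from (h0 x).2 hx)]
      · rw [visitTail_succ_of_notMem hx, visitTail_succ_of_notMem
          (show σ x ∉ ({0} : Set E) from fun h => hx ((h0 x).1 h)), hσ, funext ih]
  simp only [hitting, key]

theorem hitting_neg (hν : ν.map Neg.neg = ν) (x : E) : hitting ν (-x) = hitting ν x := by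
  refine hitting_comp (fun x => neg_eq_zero) (fun f x => ?_) x
  have h := integral_map (μ := ν) (φ := Neg.neg) (f := fun z => f (-x + z))
    Measurable.of_discrete.aemeasurable Measurable.of_discrete.aestronglyMeasurable
  rw [hν] at h
  simpa only [transition, neg_add] using h

/-- A single jump by `-x` already reaches the origin. -/
theorem real_singleton_neg_le_hitting {x : E} (hx : x ≠ 0) :
    ν.real {-x} ≤ hitting ν x := by
  rw [← transition_hitting hx]
  calc ν.real {-x} = ∫ z, ({-x} : Set E).indicator (fun _ => (1 : ℝ)) z ∂ν := by
        rw [integral_indicator (MeasurableSet.of_discrete)]; simp [Measure.real]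
    _ ≤ _ := by
      refine integral_mono (Integrable.of_bound (C := 1)
        Measurable.of_discrete.aestronglyMeasurable (Eventually.of_forall fun z => ?_))
        (integrable_of_bounds hitting_nonneg hitting_le_one x) fun z => ?_
      · by_cases hz : z = -x <;> simp [hz]
      · by_cases hz : z = -x
        · simp [hz, hitting_zero]
        · simp [hz, hitting_nonneg]

/-- The sum of the hitting probabilities of `0` and of `y`; up to normalisation, the hitting
probability of `{0, y}` by a symmetric walk. -/
noncomputable def pairPotential (ν : Measure E) (y x : E) : ℝ := hitting ν x + hitting ν (x - y)

theorem pairPotential_nonneg (y x : E) : 0 ≤ pairPotential ν y x :=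
  add_nonneg (hitting_nonneg _) (hitting_nonneg _)

theorem pairPotential_le_two (y x : E) : pairPotential ν y x ≤ 2 := by
  have := hitting_le_one (ν := ν) x
  have := hitting_le_one (ν := ν) (x - y)
  unfold pairPotential; linarith

theorem transition_pairPotential (y x : E) : transition ν (pairPotential ν y) x =
    transition ν (hitting ν) x + transition ν (hitting ν) (x - y) := by
  rw [← transition_comp_sub_right]
  exact transition_add hitting_nonneg hitting_le_one (fun _ => hitting_nonneg _)
    (fun _ => hitting_le_one _) x

/-- Split the potential into its two summands and, for each, shrink the killing set to the one point
that summand refers to; this only increases the killed expectations, which still vanish. -/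
theorem tendsto_killedIterate_pairPotential (y x : E) :
    Tendsto (fun m => killedIterate ν {0, y} (pairPotential ν y) m x) atTop (𝓝 0) := by
  have hy : ∀ z ∉ ({y} : Set E),
      transition ν (fun z => hitting ν (z - y)) z = hitting ν (z - y) := fun z hz => by
    rw [transition_comp_sub_right, transition_hitting (sub_ne_zero.2 hz)]
  have lim := (tendsto_killedIterate_hitting (ν := ν) x).add
    (tendsto_killedIterate_hitting (ν := ν) (x - y))
  rw [add_zero] at lim
  refine squeeze_zero (killedIterate_nonneg (pairPotential_nonneg y) · x) (fun m => ?_) lim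
  unfold pairPotential
  rw [killedIterate_add hitting_nonneg hitting_le_one (fun _ => hitting_nonneg _)
    (fun _ => hitting_le_one _), ← killedIterate_comp_sub_right]
  exact add_le_add
    (killedIterate_mono (A := {0}) (by simp) hitting_nonneg (fun _ => le_rfl) hitting_le_one
      (fun z hz => transition_hitting hz) m x)
    (killedIterate_mono (A := {y}) (by simp) (fun _ => hitting_nonneg _) (fun _ => le_rfl)
      (fun _ => hitting_le_one _) hy m x)

end Hitting

/-! ### From the random walk to its transition operator. -/

section Walk

set_option linter.unusedSectionVars false

variable {d : ℕ} {Ω : Type*} [MeasurableSpace Ω] {P : Measure Ω} [IsProbabilityMeasure P]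
  {X : ℕ → Ω → (Fin d → ℤ)}

/-- The number of visits of the path `x` to `A` up to time `n`. -/
noncomputable def visits (A : Set (Fin d → ℤ)) (x : ℕ → (Fin d → ℤ)) (n : ℕ) : ℕ :=
  ∑ j ∈ Finset.range (n + 1), A.indicator (fun _ => 1) (x j)

theorem occupation_eq_visits (x : ℕ → (Fin d → ℤ)) (n : ℕ) (A : Set (Fin d → ℤ)) :
    occupation x n A = visits A x n := by
  simp only [occupation, visits, Nat.cast_sum]
  refine Finset.sum_congr rfl fun j _ => ?_
  by_cases h : x j ∈ A <;> simp [h]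

theorem measurable_visits (A : Set (Fin d → ℤ)) (n : ℕ) :
    Measurable fun x : ℕ → (Fin d → ℤ) => visits A x n :=
  Finset.measurable_sum _ fun j _ =>
    (Measurable.of_discrete (f := A.indicator fun _ => (1 : ℕ))).comp (measurable_pi_apply j)

theorem visits_succ' (A : Set (Fin d → ℤ)) (x : ℕ → (Fin d → ℤ)) (n : ℕ) :
    visits A x (n + 1) = visits A (fun i => x (i + 1)) n + A.indicator (fun _ => 1) (x 0) :=
  Finset.sum_range_succ' _ _

theorem visits_congr {A : Set (Fin d → ℤ)} {x y : ℕ → (Fin d → ℤ)} {n : ℕ}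
    (h : ∀ j ≤ n, x j = y j) : visits A x n = visits A y n :=
  Finset.sum_congr rfl fun j hj => by rw [h j (Nat.lt_succ_iff.1 (Finset.mem_range.1 hj))]

theorem IsRandomWalk.shift (hX : IsRandomWalk X P) (m : ℕ) :
    IsRandomWalk (fun i ω => X (m + i) ω - X m ω) P where
  measurable n := (hX.measurable _).sub (hX.measurable _)
  start := by simp
  indep := by
    simpa [Function.comp_def, add_assoc] using
      hX.indep.precomp (g := fun n => m + n) (add_right_injective m)
  ident n := by
    simpa [add_assoc] using (hX.ident (m + n)).trans (hX.ident m).symm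

theorem IsRandomWalk.map_shift_one (hX : IsRandomWalk X P) (m : ℕ) :
    P.map (fun ω => X (m + 1) ω - X m ω) = P.map (X 1) :=
  (hX.ident m).map_eq

theorem IsRandomWalk.isProbabilityMeasure (hX : IsRandomWalk X P) :
    IsProbabilityMeasure (P.map (X 1)) :=
  Measure.isProbabilityMeasure_map (hX.measurable 1).aemeasurable

theorem comap_path_le {α β : Type*} [MeasurableSpace β] {m' : MeasurableSpace α}
    {f : α → ℕ → β} (h : ∀ i, Measurable[m'] fun ω => f ω i) :
    MeasurableSpace.comap f inferInstance ≤ m' :=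
  (measurable_pi_iff.2 h).comap_le

/-- The path up to time `m` is independent of the increments after time `m`. -/
theorem IsRandomWalk.indepFun_past_future (hX : IsRandomWalk X P) (m : ℕ) :
    IndepFun (fun ω i => X (min i m) ω - X 0 ω) (fun ω i => X (m + i) ω - X m ω) P := by
  have hξ : ∀ n, Measurable fun ω => X (n + 1) ω - X n ω := fun n =>
    (hX.measurable _).sub (hX.measurable _)
  have key := indep_iSup_of_disjoint (fun n => (hξ n).comap_le) hX.indep
    (Set.disjoint_left.2 fun i (hi : i ∈ Set.Iio m) (hj : i ∈ Set.Ici m) =>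
      (not_lt.2 hj : ¬ i < m) hi)
  have meas : ∀ (S : Set ℕ) (j : ℕ), j ∈ S → Measurable[⨆ i ∈ S, MeasurableSpace.comap
      (fun ω => X (i + 1) ω - X i ω) inferInstance] fun ω => X (j + 1) ω - X j ω :=
    fun S j hj => Measurable.of_comap_le
      (le_iSup₂ (f := fun i (_ : i ∈ S) => MeasurableSpace.comap
        (fun ω => X (i + 1) ω - X i ω) inferInstance) j hj)
  rw [IndepFun_iff_Indep]
  refine indep_of_indep_of_le_left (indep_of_indep_of_le_right key ?_) ?_
  · refine comap_path_le fun i => ?_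
    have : (fun ω => X (m + i) ω - X m ω) =
        fun ω => ∑ j ∈ Finset.range i, (X (m + j + 1) ω - X (m + j) ω) := by
      funext ω
      exact (Finset.sum_range_sub (fun j => X (m + j) ω) i).symm
    rw [this]
    exact Finset.measurable_sum _ fun j _ => meas _ (m + j) (Nat.le_add_right m j)
  · refine comap_path_le fun i => ?_
    have : (fun ω => X (min i m) ω - X 0 ω) =
        fun ω => ∑ j ∈ Finset.range (min i m), (X (j + 1) ω - X j ω) := by
      funext ω
      exact (Finset.sum_range_sub (fun j => X j ω) _).symm
    rw [this]
    exact Finset.measurable_sum _ fun j hj =>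
      meas _ j ((Finset.mem_range.1 hj).trans_le (min_le_right i m))

/-- Fubini for the product law: conditioning on `U` amounts to freezing its value. This is the form
of the Markov property used at the first step. -/
theorem real_prod_mem_of_indepFun {α β : Type*} [MeasurableSpace α] [MeasurableSpace β]
    {U : Ω → α} {V : Ω → β} (hU : Measurable U) (hV : Measurable V) (h : IndepFun U V P)
    {S : Set (α × β)} (hS : MeasurableSet S) :
    P.real {ω | (U ω, V ω) ∈ S} = ∫ u, P.real {ω | (u, V ω) ∈ S} ∂(P.map U) := by
  have hprod := (indepFun_iff_map_prod_eq_prod_map_map hU.aemeasurable hV.aemeasurable).1 h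
  have := Measure.isProbabilityMeasure_map (μ := P) hU.aemeasurable
  have := Measure.isProbabilityMeasure_map (μ := P) hV.aemeasurable
  have h1 : P {ω | (U ω, V ω) ∈ S} = ∫⁻ u, P {ω | (u, V ω) ∈ S} ∂(P.map U) := by
    have : P {ω | (U ω, V ω) ∈ S} = P.map (fun ω => (U ω, V ω)) S :=
      (Measure.map_apply (hU.prodMk hV) hS).symm
    rw [this, hprod, Measure.prod_apply hS]
    refine lintegral_congr fun u => ?_
    rw [Measure.map_apply hV (measurable_prodMk_left hS)]
    rfl
  have h2 : Measurable fun u => P {ω | (u, V ω) ∈ S} := by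
    have h3 := measurable_measure_prodMk_left (ν := P.map V) hS
    have h4 : (fun u => P.map V (Prod.mk u ⁻¹' S)) = fun u => P {ω | (u, V ω) ∈ S} :=
      funext fun u => Measure.map_apply hV (measurable_prodMk_left hS)
    rwa [h4] at h3
  simp only [Measure.real]
  rw [h1, integral_toReal h2.aemeasurable (Eventually.of_forall fun u => measure_lt_top _ _)]

/-- `visitTail` is the tail of the number of visits of the walk started at `x`. -/
theorem IsRandomWalk.real_le_visits (hX : IsRandomWalk X P) (A : Set (Fin d → ℤ)) (n : ℕ)
    (x : Fin d → ℤ) (k : ℕ) :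
    P.real {ω | k ≤ visits A (fun i => x + X i ω) n} = visitTail (P.map (X 1)) A n x k := by
  induction n generalizing X x k with
  | zero =>
    have : {ω | k ≤ visits A (fun i => x + X i ω) 0} =ᵐ[P]
        {_ω | k ≤ A.indicator (fun _ => 1) x} := by
      filter_upwards [hX.start] with ω hω
      refine propext ?_
      change k ≤ visits A (fun i => x + X i ω) 0 ↔ k ≤ A.indicator (fun _ => 1) x
      simp [visits, hω]
    rw [measureReal_congr this, visitTail]
    split_ifs with h <;> simp [h]
  | succ n ih =>
    have hU : Measurable fun ω => X 1 ω - X 0 ω := (hX.measurable 1).sub (hX.measurable 0)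
    have hV : Measurable fun ω i => X (1 + i) ω - X 1 ω :=
      measurable_pi_iff.2 fun i => (hX.measurable _).sub (hX.measurable _)
    have hind : IndepFun (fun ω => X 1 ω - X 0 ω) (fun ω i => X (1 + i) ω - X 1 ω) P :=
      (hX.indepFun_past_future 1).comp (φ := fun p : ℕ → (Fin d → ℤ) => p 1)
        (measurable_pi_apply 1) measurable_id
    set a := A.indicator (fun _ => 1) x with ha
    set S : Set ((Fin d → ℤ) × (ℕ → (Fin d → ℤ))) :=
      {q | k - a ≤ visits A (fun i => (x + q.1) + q.2 i) n} with hS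
    have hSm : MeasurableSet S := by
      have : Measurable fun q : (Fin d → ℤ) × (ℕ → (Fin d → ℤ)) =>
          visits A (fun i => (x + q.1) + q.2 i) n :=
        (measurable_visits A n).comp (measurable_pi_iff.2 fun i =>
          (measurable_const.add measurable_fst).add ((measurable_pi_apply i).comp measurable_snd))
      exact this measurableSet_Ici
    have h1 : {ω | k ≤ visits A (fun i => x + X i ω) (n + 1)} =ᵐ[P]
        {ω | (X 1 ω - X 0 ω, fun i => X (1 + i) ω - X 1 ω) ∈ S} := by
      filter_upwards [hX.start] with ω hω
      refine propext ?_
      change k ≤ visits A (fun i => x + X i ω) (n + 1) ↔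
        k - a ≤ visits A (fun i => (x + (X 1 ω - X 0 ω)) + (X (1 + i) ω - X 1 ω)) n
      rw [visits_succ', hω, add_zero, ← ha, tsub_le_iff_right]
      have : (fun i => x + X (i + 1) ω) =
          fun i => (x + (X 1 ω - 0)) + (X (1 + i) ω - X 1 ω) := by
        funext i; rw [add_comm i 1]; abel
      rw [this]
    rw [measureReal_congr h1, real_prod_mem_of_indepFun hU hV hind hSm, visitTail,
      (hX.ident 0).map_eq]
    refine integral_congr_ae (Eventually.of_forall fun z => ?_)
    have := ih (hX.shift 1) (x + z) (k - a)
    rw [hX.map_shift_one 1] at this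
    exact this

/-- Union bound over the time of the first visit to a translate of `A`. -/
theorem IsRandomWalk.measure_exists_le_visits (hX : IsRandomWalk X P) {A : Set (Fin d → ℤ)}
    (hA : A.Finite) (n k : ℕ) :
    P {ω | ∃ z, k + 1 ≤ visits ((fun a => z + a) '' A) (fun i => X i ω) n} ≤
      ENNReal.ofReal ((n + 1) * ∑ a ∈ hA.toFinset, visitTail (P.map (X 1)) A n a (k + 1)) := by
  -- There are infinitely many `z`, but if the translate is first visited at time `j`, at its point
  -- `z + a`, then `z = X j - a`. So `(n + 1)` times and the points of `A` index all cases.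
  have hsub : {ω | ∃ z, k + 1 ≤ visits ((fun a => z + a) '' A) (fun i => X i ω) n} ⊆
      ⋃ j ∈ Finset.range (n + 1), ⋃ a ∈ hA.toFinset,
        {ω | k + 1 ≤ visits A (fun i => a + (X (j + i) ω - X j ω)) n} := by
    rintro ω ⟨z, hz⟩
    have hmem : ∃ j, j < n + 1 ∧ X j ω ∈ (fun a => z + a) '' A := by
      by_contra hno
      push Not at hno
      have : visits ((fun a => z + a) '' A) (fun i => X i ω) n = 0 :=
        Finset.sum_eq_zero fun j hj =>
          Set.indicator_of_notMem (hno j (Finset.mem_range.1 hj)) _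
      omega
    classical
    obtain ⟨hj, a, haA, ha⟩ := Nat.find_spec hmem
    have hmin : ∀ i < Nat.find hmem, X i ω ∉ (fun a => z + a) '' A := fun i hi hi' =>
      Nat.find_min hmem hi ⟨hi.trans hj, hi'⟩
    set j := Nat.find hmem
    simp only [Set.mem_iUnion, Set.mem_ofPred_eq]
    refine ⟨j, Finset.mem_range.2 hj, a, hA.mem_toFinset.2 haA, hz.trans ?_⟩
    have hiff : ∀ i, ((fun a => z + a) '' A).indicator (fun _ => 1) (X i ω) =
        A.indicator (fun _ => 1) (X i ω - z) := fun i => by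
      have : X i ω ∈ (fun a => z + a) '' A ↔ X i ω - z ∈ A := by
        constructor
        · rintro ⟨b, hb, hb'⟩; rw [← hb']; simpa using hb
        · intro h; exact ⟨_, h, by simp⟩
      by_cases h : X i ω - z ∈ A
      · rw [Set.indicator_of_mem h, Set.indicator_of_mem (this.2 h)]
      · rw [Set.indicator_of_notMem h, Set.indicator_of_notMem (fun h' => h (this.1 h'))]
    have hshift : ∀ i, a + (X (j + i) ω - X j ω) = X (j + i) ω - z := fun i => by
      simp only [← ha]; abel
    simp only [visits, hshift]
    obtain ⟨l, hl⟩ : ∃ l, n + 1 = j + l := ⟨n + 1 - j, by omega⟩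
    calc ∑ i ∈ Finset.range (n + 1), ((fun a => z + a) '' A).indicator (fun _ => 1) (X i ω)
        = ∑ i ∈ Finset.range l, ((fun a => z + a) '' A).indicator (fun _ => 1) (X (j + i) ω) := by
          rw [hl, Finset.sum_range_add, Finset.sum_eq_zero, zero_add]
          exact fun i hi => Set.indicator_of_notMem (hmin i (Finset.mem_range.1 hi)) _
      _ = ∑ i ∈ Finset.range l, A.indicator (fun _ => 1) (X (j + i) ω - z) :=
          Finset.sum_congr rfl fun i _ => hiff _
      _ ≤ _ := Finset.sum_le_sum_of_subset (Finset.range_mono (by omega))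
  have hterm : ∀ j a, P {ω | k + 1 ≤ visits A (fun i => a + (X (j + i) ω - X j ω)) n} =
      ENNReal.ofReal (visitTail (P.map (X 1)) A n a (k + 1)) := fun j a => by
    rw [← hX.map_shift_one j, ← (hX.shift j).real_le_visits A n a (k + 1), ofReal_measureReal]
  have := hX.isProbabilityMeasure
  calc _ ≤ _ := measure_mono hsub
    _ ≤ ∑ j ∈ Finset.range (n + 1), P (⋃ a ∈ hA.toFinset,
        {ω | k + 1 ≤ visits A (fun i => a + (X (j + i) ω - X j ω)) n}) :=
      measure_biUnion_finset_le _ _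
    _ ≤ ∑ j ∈ Finset.range (n + 1), ∑ a ∈ hA.toFinset,
        ENNReal.ofReal (visitTail (P.map (X 1)) A n a (k + 1)) :=
      Finset.sum_le_sum fun j _ => (measure_biUnion_finset_le _ _).trans
        (Finset.sum_le_sum fun a _ => (hterm j a).le)
    _ = _ := by
      rw [Finset.sum_const, Finset.card_range,
        ← ENNReal.ofReal_sum_of_nonneg fun a _ => visitTail_nonneg _ _ _, nsmul_eq_mul,
        ENNReal.ofReal_mul (by positivity)]
      congr 1
      rw [← Nat.cast_succ, ENNReal.ofReal_natCast]

theorem measurableSet_le_visits {Y : ℕ → Ω → (Fin d → ℤ)} (hY : ∀ i, Measurable (Y i))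
    (A : Set (Fin d → ℤ)) (n k : ℕ) : MeasurableSet {ω | k ≤ visits A (fun i => Y i ω) n} :=
  ((measurable_visits A n).comp (measurable_pi_iff.2 hY)) measurableSet_Ici

/-- Disjoint time blocks behave independently. -/
theorem IsRandomWalk.real_forall_block_lt (hX : IsRandomWalk X P) (A : Set (Fin d → ℤ))
    (a : Fin d → ℤ) (m k B : ℕ) :
    P.real {ω | ∀ b < B, visits A (fun i => a + (X (b * m + i) ω - X (b * m) ω)) m < k} =
      (1 - visitTail (P.map (X 1)) A m a k) ^ B := by
  induction B generalizing X with
  | zero => simp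
  | succ B ih =>
    set T : Set (ℕ → (Fin d → ℤ)) := {p | visits A (fun i => a + p i) m < k} with hT
    set U : Set (ℕ → (Fin d → ℤ)) :=
      {p | ∀ b < B, visits A (fun i => a + (p (b * m + i) - p (b * m))) m < k} with hU
    have hvis : ∀ f : ℕ → (ℕ → (Fin d → ℤ)) → (Fin d → ℤ), (∀ i, Measurable (f i)) →
        MeasurableSet {p : ℕ → (Fin d → ℤ) | visits A (fun i => f i p) m < k} := fun f hf =>
      ((measurable_visits A m).comp (measurable_pi_iff.2 hf)) measurableSet_Iio
    have hTm : MeasurableSet T := 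
      hvis (fun i p => a + p i) fun i => by fun_prop
    have hUm : MeasurableSet U := by
      have : U = ⋂ b, ⋂ (_ : b < B),
          {p | visits A (fun i => a + (p (b * m + i) - p (b * m))) m < k} := by
        ext p; simp [hU]
      rw [this]
      exact MeasurableSet.iInter fun b => MeasurableSet.iInter fun _ => 
        hvis (fun i p => a + (p (b * m + i) - p (b * m))) fun i => by fun_prop
    -- Consecutive blocks share an endpoint but use disjoint increments, so the first block splits
    -- off as the past of time `m`. Freezing the path at `min i m` is harmless for visits up to time
    -- `m`.
    have hset : {ω | ∀ b < B + 1,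
        visits A (fun i => a + (X (b * m + i) ω - X (b * m) ω)) m < k} =
        (fun ω i => X (min i m) ω - X 0 ω) ⁻¹' T ∩ (fun ω i => X (m + i) ω - X m ω) ⁻¹' U := by
      ext ω
      simp only [Set.mem_ofPred_eq, Set.mem_inter_iff, Set.mem_preimage, hT, hU,
        Nat.forall_lt_succ_left, sub_sub_sub_cancel_right]
      refine and_congr ?_ ?_
      · rw [visits_congr fun j hj => ?_]
        simp [min_eq_left hj]
      · refine forall₂_congr fun b _ => ?_
        have h0 : (b + 1) * m = m + b * m := by ring
        simp only [h0, add_assoc]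
    have hTP : P.real ((fun ω i => X (min i m) ω - X 0 ω) ⁻¹' T) =
        1 - visitTail (P.map (X 1)) A m a k := by
      rw [← hX.real_le_visits, ← probReal_compl_eq_one_sub
        (measurableSet_le_visits (fun i => (hX.measurable i).const_add a) A m k)]
      refine measureReal_congr ?_
      filter_upwards [hX.start] with ω hω
      refine propext ?_
      change visits A (fun i => a + (X (min i m) ω - X 0 ω)) m < k ↔
        ¬ k ≤ visits A (fun i => a + X i ω) m
      rw [not_le, hω, visits_congr fun j hj => ?_]
      simp [min_eq_left hj]
    have hind := (hX.indepFun_past_future m).measure_inter_preimage_eq_mul _ _ hTm hUm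
    rw [hset, Measure.real, hind, ENNReal.toReal_mul]
    change P.real _ * P.real _ = _
    have := ih (hX.shift m)
    rw [hX.map_shift_one m] at this
    rw [hTP, pow_succ', ← this]
    rfl

theorem visits_mem_zero_iff {x : ℕ → (Fin d → ℤ)} {n : ℕ} :
    1 ≤ visits {0} x n ↔ ∃ s ≤ n, x s = 0 := by
  rw [Nat.one_le_iff_ne_zero, visits, Ne, Finset.sum_eq_zero_iff]
  simp only [Finset.mem_range, Nat.lt_succ_iff, not_forall, exists_prop]
  refine exists_congr fun s => and_congr_right fun _ => ?_
  by_cases h : x s = 0 <;> simp [h]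

theorem IsRandomWalk.real_exists_eq (hX : IsRandomWalk X P) (x : Fin d → ℤ) :
    P.real {ω | ∃ s, x + X s ω = 0} = hitting (P.map (X 1)) x := by
  have := hX.isProbabilityMeasure
  have hmono : Monotone fun n => {ω | ∃ s ≤ n, x + X s ω = 0} :=
    fun n n' hn ω ⟨s, hs, h⟩ => ⟨s, hs.trans hn, h⟩
  have h := tendsto_measure_iUnion_atTop (μ := P) hmono
  have hU : ⋃ n, {ω | ∃ s ≤ n, x + X s ω = 0} = {ω | ∃ s, x + X s ω = 0} := by
    ext ω
    simp only [Set.mem_iUnion, Set.mem_ofPred_eq]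
    exact ⟨fun ⟨_, s, _, h⟩ => ⟨s, h⟩, fun ⟨s, h⟩ => ⟨s, s, le_rfl, h⟩⟩
  rw [hU] at h
  refine tendsto_nhds_unique ((ENNReal.tendsto_toReal (measure_ne_top _ _)).comp h) ?_
  refine (tendsto_hitting x).congr fun n => ?_
  rw [← hX.real_le_visits]
  simp only [visits_mem_zero_iff]
  rfl

/-- Reaching `y` from `0` is reaching `0` from `-y`; since `y ≠ 0`, time zero does not count. -/
theorem IsRandomWalk.hitProb_eq (hX : IsRandomWalk X P) {y : Fin d → ℤ} (hy : y ≠ 0) :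
    hitProb X P y = hitting (P.map (X 1)) (-y) := by
  rw [← hX.real_exists_eq]
  refine measureReal_congr ?_
  filter_upwards [hX.start] with ω hω
  refine propext ?_
  change (∃ s, 0 < s ∧ X s ω = y) ↔ ∃ s, -y + X s ω = 0
  refine ⟨fun ⟨s, _, h⟩ => ⟨s, by rw [h]; simp⟩, fun ⟨s, h⟩ => ⟨s, ?_, ?_⟩⟩
  · rcases Nat.eq_zero_or_pos s with rfl | hs
    · rw [hω] at h; simp at h; exact absurd h hy
    · exact hs
  · rwa [neg_add_eq_zero, eq_comm] at h

/-- Condition on the first step: a return to `0` is a visit to `0` from the position at time `1`. -/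
theorem IsRandomWalk.noReturnProb_eq (hX : IsRandomWalk X P) :
    noReturnProb X P = 1 - transition (P.map (X 1)) (hitting (P.map (X 1))) 0 := by
  have hU : Measurable fun ω => X 1 ω - X 0 ω := (hX.measurable 1).sub (hX.measurable 0)
  have hV : Measurable fun ω i => X (1 + i) ω - X 1 ω :=
    measurable_pi_iff.2 fun i => (hX.measurable _).sub (hX.measurable _)
  have hind : IndepFun (fun ω => X 1 ω - X 0 ω) (fun ω i => X (1 + i) ω - X 1 ω) P :=
    (hX.indepFun_past_future 1).comp (φ := fun p : ℕ → (Fin d → ℤ) => p 1)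
      (measurable_pi_apply 1) measurable_id
  have hSm : MeasurableSet {q : (Fin d → ℤ) × (ℕ → (Fin d → ℤ)) | ∃ s, q.1 + q.2 s = 0} := by
    simp only [Set.ofPred_exists]
    refine MeasurableSet.iUnion fun s => ?_
    have : Measurable fun q : (Fin d → ℤ) × (ℕ → (Fin d → ℤ)) => q.1 + q.2 s :=
      measurable_fst.add ((measurable_pi_apply s).comp measurable_snd)
    exact this (measurableSet_singleton 0)
  have h := real_prod_mem_of_indepFun hU hV hind hSm
  have hr : transition (P.map (X 1)) (hitting (P.map (X 1))) 0 =
      P.real {ω | ∃ s, 0 < s ∧ X s ω = 0} := by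
    have h1 : {ω | ∃ s, 0 < s ∧ X s ω = 0} =ᵐ[P]
        {ω | ∃ s, (X 1 ω - X 0 ω) + (X (1 + s) ω - X 1 ω) = 0} := by
      filter_upwards [hX.start] with ω hω
      refine propext ?_
      change (∃ s, 0 < s ∧ X s ω = 0) ↔ ∃ s, (X 1 ω - X 0 ω) + (X (1 + s) ω - X 1 ω) = 0
      simp only [hω, sub_zero, add_sub_cancel]
      exact ⟨fun ⟨s, hs, h⟩ => ⟨s - 1, by rwa [Nat.add_sub_cancel' hs]⟩,
        fun ⟨s, h⟩ => ⟨1 + s, by omega, h⟩⟩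
    rw [measureReal_congr h1]
    refine Eq.trans ?_ h.symm
    rw [(hX.ident 0).map_eq]
    refine integral_congr_ae (Eventually.of_forall fun z => ?_)
    have := (hX.shift 1).real_exists_eq z
    rw [hX.map_shift_one 1] at this
    simp only [zero_add]
    exact this.symm
  rw [hr, ← probReal_compl_eq_one_sub]
  · rw [noReturnProb]; congr 1; ext ω; simp
  · simp only [Set.ofPred_exists, Set.ofPred_and]
    exact MeasurableSet.iUnion fun s => (MeasurableSet.const _).inter
      (hX.measurable s (measurableSet_singleton 0))

end Walk

/-! ### Almost sure asymptotics from an eigenfunction. -/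

section Limit

variable {d : ℕ}

theorem visits_mono (A : Set (Fin d → ℤ)) (x : ℕ → (Fin d → ℤ)) : Monotone (visits A x) :=
  fun _ _ h => Finset.sum_le_sum_of_subset (Finset.range_mono (Nat.succ_le_succ h))

theorem visits_le (A : Set (Fin d → ℤ)) (x : ℕ → (Fin d → ℤ)) (n : ℕ) : visits A x n ≤ n + 1 := by
  calc visits A x n ≤ ∑ _j ∈ Finset.range (n + 1), 1 :=
        Finset.sum_le_sum fun j _ => Set.indicator_le_self' (by simp) _
    _ = n + 1 := by simp

/-- Interpolation between powers of two. -/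
theorem tendsto_maxOccupationRatio_of_dyadic {x : ℕ → (Fin d → ℤ)} {A : Set (Fin d → ℤ)} {c : ℝ}
    (hc : 0 < c)
    (hU : ∀ q : ℚ, c < q → ∀ᶠ l : ℕ in atTop, ∀ z,
      (visits ((fun a => z + a) '' A) x (2 ^ l) : ℝ) ≤ q * (l * Real.log 2))
    (hL : ∀ q : ℚ, 0 < (q : ℝ) → q < c → ∀ᶠ l : ℕ in atTop, ∃ z,
      q * (l * Real.log 2) ≤ visits ((fun a => z + a) '' A) x (2 ^ l)) :
    Tendsto (maxOccupationRatio x A) atTop (𝓝 c) := by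
  have hlog2 : 0 < Real.log 2 := Real.log_pos one_lt_two
  have hlog : Tendsto (fun n => Nat.log 2 n) atTop atTop :=
    tendsto_atTop.2 fun b => (eventually_ge_atTop (2 ^ b)).mono fun n hn =>
      Nat.le_log_of_pow_le one_lt_two hn
  have lower : ∀ {n : ℕ}, 1 ≤ n → (Nat.log 2 n : ℝ) * Real.log 2 ≤ Real.log n := fun {n} hn => by
    rw [← Real.log_pow]
    exact Real.log_le_log (by positivity) (by exact_mod_cast Nat.pow_log_le_self 2 (by omega))
  have upper : ∀ {n : ℕ}, 1 ≤ n → Real.log n ≤ ((Nat.log 2 n + 1 : ℕ) : ℝ) * Real.log 2 :=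
    fun {n} hn => by
      rw [← Real.log_pow]
      exact Real.log_le_log (by exact_mod_cast hn)
        (by exact_mod_cast (Nat.lt_pow_succ_log_self one_lt_two n).le)
  refine tendsto_order.2 ⟨fun b hb => ?_, fun b hb => ?_⟩
  · obtain ⟨q, hq1, hq2⟩ := exists_rat_btwn (max_lt hb hc)
    have hq0 : 0 < (q : ℝ) := (le_max_right _ _).trans_lt hq1
    -- The lower threshold was taken as `max b 0` because `hL` needs `q` positive. With `L = Nat.log
    -- 2 n`, `hlarge` will mean `b * (L + 1) < q * L`, which absorbs the error of dyadic rounding.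
    have hbq : b < q := (le_max_left _ _).trans_lt hq1
    filter_upwards [hlog.eventually (hL q hq0 hq2), eventually_ge_atTop 2,
      hlog.eventually ((tendsto_natCast_atTop_atTop (R := ℝ)).eventually_gt_atTop (b / (q - b)))]
      with n ⟨z, hz⟩ hn2 hlarge
    have hn1 : 1 ≤ n := by omega
    have hln : 0 < Real.log n := Real.log_pos (by exact_mod_cast hn2)
    have hbdd : BddAbove (Set.range fun z : Fin d → ℤ =>
        occupation x n ((fun a => z + a) '' A) / Real.log n) := by
      refine ⟨(n + 1) / Real.log n, ?_⟩
      rintro _ ⟨z, rfl⟩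
      simp only [occupation_eq_visits]
      gcongr
      exact_mod_cast visits_le _ x n
    refine lt_of_lt_of_le ?_ (le_ciSup hbdd z)
    rw [lt_div_iff₀ hln, occupation_eq_visits]
    have hv : (visits ((fun a => z + a) '' A) x (2 ^ Nat.log 2 n) : ℝ) ≤
        visits ((fun a => z + a) '' A) x n := by
      exact_mod_cast visits_mono _ x (Nat.pow_log_le_self 2 (by omega))
    refine lt_of_lt_of_le ?_ (hz.trans hv)
    rw [div_lt_iff₀ (sub_pos.2 hbq)] at hlarge
    rcases le_or_gt b 0 with hb0 | hb0
    · have h1 : 0 < Nat.log 2 n := Nat.log_pos one_lt_two hn2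
      exact (mul_nonpos_of_nonpos_of_nonneg hb0 hln.le).trans_lt (by positivity)
    · calc b * Real.log n ≤ b * (((Nat.log 2 n + 1 : ℕ) : ℝ) * Real.log 2) := by
            gcongr; exact upper hn1
        _ = (b * (Nat.log 2 n + 1)) * Real.log 2 := by push_cast; ring
        _ < (q * Nat.log 2 n) * Real.log 2 := by
            refine mul_lt_mul_of_pos_right ?_ hlog2
            linarith
        _ = _ := by ring
  · obtain ⟨q, hq1, hq2⟩ := exists_rat_btwn hb
    have hq0 : 0 < (q : ℝ) := hc.trans hq1
    filter_upwards [((tendsto_add_atTop_nat 1).comp hlog).eventually (hU q hq1),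
      eventually_ge_atTop 2,
      hlog.eventually ((tendsto_natCast_atTop_atTop (R := ℝ)).eventually_gt_atTop (q / (b - q)))]
      with n hz hn2 hlarge
    have hn1 : 1 ≤ n := by omega
    have hln : 0 < Real.log n := Real.log_pos (by exact_mod_cast hn2)
    rw [div_lt_iff₀ (sub_pos.2 hq2)] at hlarge
    have hle : maxOccupationRatio x A n ≤
        q * (((Nat.log 2 n + 1 : ℕ) : ℝ) * Real.log 2) / Real.log n := by
      refine ciSup_le fun z => ?_
      rw [occupation_eq_visits]
      gcongr
      refine le_trans ?_ (hz z)
      exact_mod_cast visits_mono _ x (Nat.lt_pow_succ_log_self one_lt_two n).le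
    refine hle.trans_lt ?_
    rw [div_lt_iff₀ hln]
    calc q * (((Nat.log 2 n + 1 : ℕ) : ℝ) * Real.log 2)
        = (q * (Nat.log 2 n + 1)) * Real.log 2 := by push_cast; ring
      _ < (b * Nat.log 2 n) * Real.log 2 := by
          refine mul_lt_mul_of_pos_right ?_ hlog2
          linarith
      _ = b * (Nat.log 2 n * Real.log 2) := by ring
      _ ≤ b * Real.log n := by
          have : 0 < b := hc.trans hb
          gcongr
          exact lower hn1

variable {Ω : Type*} [MeasurableSpace Ω] {P : Measure Ω}

theorem ae_eventually_notMem_of_geometric {s : ℕ → Set Ω} {C ρ : ℝ} (hρ0 : 0 ≤ ρ) (hρ1 : ρ < 1)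
    (h : ∀ᶠ l in atTop, P (s l) ≤ ENNReal.ofReal (C * ρ ^ l)) :
    ∀ᵐ ω ∂P, ∀ᶠ l in atTop, ω ∉ s l := by
  obtain ⟨N, hN⟩ := eventually_atTop.1 h
  have hsum : Summable fun l : ℕ => C * ρ ^ (l + N) :=
    ((summable_nat_add_iff N).2 (summable_geometric_of_lt_one hρ0 hρ1)).mul_left C
  have hfin : ∑' l, P (s (l + N)) ≠ ⊤ :=
    ne_top_of_le_ne_top hsum.tsum_ofReal_ne_top
      (ENNReal.tsum_le_tsum fun l => hN (l + N) (Nat.le_add_left N l))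
  filter_upwards [ae_eventually_notMem hfin] with ω hω
  obtain ⟨M, hM⟩ := eventually_atTop.1 hω
  refine eventually_atTop.2 ⟨M + N, fun l hl => ?_⟩
  have := hM (l - N) (by omega)
  rwa [Nat.sub_add_cancel (by omega)] at this

variable [IsProbabilityMeasure P] {X : ℕ → Ω → (Fin d → ℤ)}

/-- The union bound at time `2 ^ l` with `k ≈ q * l * log 2` is of order `2 ^ l * r ^ k = ρ ^ l`,
where `ρ = 2 ^ (1 + q * log r)`. The condition on `q` is exactly `ρ < 1`, and Borel–Cantelli
applies. -/
theorem IsRandomWalk.ae_eventually_visits_le (hX : IsRandomWalk X P) {A : Set (Fin d → ℤ)}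
    (hA : A.Finite) {D r q : ℝ} (hr0 : 0 < r) (hr1 : r < 1)
    (hD : ∀ n k, ∀ a ∈ A, visitTail (P.map (X 1)) A n a (k + 1) ≤ D * r ^ k)
    (hq : -1 / Real.log r < q) :
    ∀ᵐ ω ∂P, ∀ᶠ l : ℕ in atTop, ∀ z,
      (visits ((fun a => z + a) '' A) (fun i => X i ω) (2 ^ l) : ℝ) ≤ q * (l * Real.log 2) := by
  have := hX.isProbabilityMeasure
  have hlog2 : 0 < Real.log 2 := Real.log_pos one_lt_two
  have hL : Real.log r < 0 := Real.log_neg hr0 hr1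
  have hq0 : 0 < q := (div_pos_of_neg_of_neg (by norm_num) hL).trans hq
  have hqL : 1 + q * Real.log r < 0 := by
    rw [div_lt_iff_of_neg hL] at hq
    linarith
  set ρ := Real.exp (Real.log 2 * (1 + q * Real.log r)) with hρ
  have hρ1 : ρ < 1 := by
    rw [hρ, Real.exp_lt_one_iff]; exact mul_neg_of_pos_of_neg hlog2 hqL
  set K : ℕ → ℕ := fun l => ⌊q * (l * Real.log 2)⌋₊ with hK
  have hbound : ∀ l : ℕ, P {ω | ∃ z, K l + 1 ≤ visits ((fun a => z + a) '' A)
      (fun i => X i ω) (2 ^ l)} ≤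
      ENNReal.ofReal ((2 * (hA.toFinset.card * (max D 0 * r⁻¹))) * ρ ^ l) := by
    intro l
    refine (hX.measure_exists_le_visits hA (2 ^ l) (K l)).trans (ENNReal.ofReal_le_ofReal ?_)
    have hrK : r ^ K l ≤ r⁻¹ * Real.exp (Real.log r * (q * (l * Real.log 2))) := by
      rw [← Real.rpow_natCast, Real.rpow_def_of_pos hr0, ← Real.exp_log (inv_pos.2 hr0),
        ← Real.exp_add, Real.log_inv, Real.exp_le_exp]
      have := Nat.lt_floor_add_one (q * (l * Real.log 2))
      nlinarith
    have hρl : ρ ^ l = 2 ^ l * Real.exp (Real.log r * (q * (l * Real.log 2))) := by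
      rw [hρ, ← Real.exp_nat_mul, ← Real.exp_log (show (0 : ℝ) < 2 ^ l by positivity),
        ← Real.exp_add, Real.log_pow]
      congr 1; ring
    have hsum : ∑ a ∈ hA.toFinset, visitTail (P.map (X 1)) A (2 ^ l) a (K l + 1) ≤
        hA.toFinset.card * (max D 0 * (r⁻¹ * Real.exp (Real.log r * (q * (l * Real.log 2))))) := by
      rw [← nsmul_eq_mul]
      refine Finset.sum_le_card_nsmul _ _ _ fun a ha => ?_
      refine (hD _ _ a (hA.mem_toFinset.1 ha)).trans ?_
      exact mul_le_mul (le_max_left _ _) hrK (by positivity) (le_max_right _ _)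
    have h2 : ((2 ^ l : ℕ) : ℝ) + 1 ≤ 2 * 2 ^ l := by
      have : (1 : ℝ) ≤ 2 ^ l := one_le_pow₀ one_le_two
      push_cast; linarith
    calc _ ≤ (2 * 2 ^ l) * (hA.toFinset.card *
          (max D 0 * (r⁻¹ * Real.exp (Real.log r * (q * (l * Real.log 2)))))) :=
        mul_le_mul h2 hsum (Finset.sum_nonneg fun a _ => visitTail_nonneg _ _ _) (by positivity)
      _ = _ := by rw [hρl]; ring
  filter_upwards [ae_eventually_notMem_of_geometric (Real.exp_nonneg _) hρ1
    (Eventually.of_forall hbound)] with ω hω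
  filter_upwards [hω] with l hl z
  by_contra hcon
  refine hl ⟨z, ?_⟩
  rw [not_le] at hcon
  exact Nat.succ_le_of_lt ((Nat.floor_lt (by positivity)).2 hcon)

/-- Cut `[0, 2 ^ l]` into `B l` independent blocks of length `m * K l`. Each succeeds with
probability of order at least `r ^ K l`, so the expected number of successes grows like `ρ ^ l / l`
at least, now with `ρ > 1`. -/
theorem IsRandomWalk.ae_eventually_le_visits (hX : IsRandomWalk X P) {A : Set (Fin d → ℤ)}
    {a : Fin d → ℤ} {κ r q : ℝ} {m : ℕ} (hr0 : 0 < r) (hr1 : r < 1) (hκ : 0 < κ)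
    (hlow : ∀ k, κ * r ^ k ≤ visitTail (P.map (X 1)) A (m * k) a (k + 1))
    (hq0 : 0 < q) (hq : q < -1 / Real.log r) (hm : 0 < m) :
    ∀ᵐ ω ∂P, ∀ᶠ l : ℕ in atTop, ∃ z,
      q * (l * Real.log 2) ≤ visits ((fun a => z + a) '' A) (fun i => X i ω) (2 ^ l) := by
  have := hX.isProbabilityMeasure
  have hlog2 : 0 < Real.log 2 := Real.log_pos one_lt_two
  have hL : Real.log r < 0 := Real.log_neg hr0 hr1
  have hqL : 0 < 1 + q * Real.log r := by
    rw [lt_div_iff_of_neg hL] at hq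
    linarith
  set ρ := Real.exp (Real.log 2 * (1 + q * Real.log r)) with hρ
  have hρ1 : 1 < ρ := by
    rw [hρ, Real.one_lt_exp_iff]; exact mul_pos hlog2 hqL
  set K : ℕ → ℕ := fun l => ⌈q * (l * Real.log 2)⌉₊ with hK
  set B : ℕ → ℕ := fun l => 2 ^ l / (m * K l) with hB
  set s : ℕ → Set Ω := fun l => {ω | ∀ b < B l, visits A
    (fun i => a + (X (b * (m * K l) + i) ω - X (b * (m * K l)) ω)) (m * K l) < K l + 1} with hs
  -- This is tuned to give `u * B l ≥ l` below, for the success probability `u` of one block, whence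
  -- all blocks fail with probability at most `exp (-l)`.
  have hgrow : ∀ᶠ l : ℕ in atTop,
      ((l : ℝ) + 1) * (m * (q * (l * Real.log 2) + 1)) ≤ κ * r * ρ ^ l := by
    have ht := (tendsto_pow_const_div_const_pow_of_one_lt 2 hρ1).const_mul
      (2 * (m * (q * Real.log 2 + 1)))
    rw [mul_zero] at ht
    filter_upwards [ht.eventually_lt_const (mul_pos hκ hr0), eventually_ge_atTop 1] with l hl hl1
    rw [← mul_div_assoc, div_lt_iff₀ (by positivity)] at hl
    refine le_trans ?_ hl.le
    have hl1' : (1 : ℝ) ≤ l := by exact_mod_cast hl1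
    calc ((l : ℝ) + 1) * (m * (q * (l * Real.log 2) + 1))
        ≤ (l + l) * (m * (q * (l * Real.log 2) + l)) := by gcongr
      _ = _ := by ring
  have hbound : ∀ᶠ l : ℕ in atTop, P (s l) ≤ ENNReal.ofReal (1 * Real.exp (-1) ^ l) := by
    filter_upwards [hgrow, eventually_ge_atTop 1] with l hl hl1
    have hKpos : 0 < K l := Nat.ceil_pos.2 (by positivity)
    have hmK : 0 < m * K l := Nat.mul_pos hm hKpos
    set u := visitTail (P.map (X 1)) A (m * K l) a (K l + 1) with hu
    have hu1 : u ≤ 1 := visitTail_le_one _ _ _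
    have hu0 : 0 ≤ u := visitTail_nonneg _ _ _
    have hrK : r * Real.exp (Real.log r * (q * (l * Real.log 2))) ≤ r ^ K l := by
      rw [← Real.rpow_natCast, Real.rpow_def_of_pos hr0]
      nth_rewrite 1 [← Real.exp_log hr0]
      rw [← Real.exp_add, Real.exp_le_exp]
      have := Nat.ceil_lt_add_one (show 0 ≤ q * (l * Real.log 2) by positivity)
      nlinarith
    have hρl : ρ ^ l = 2 ^ l * Real.exp (Real.log r * (q * (l * Real.log 2))) := by
      rw [hρ, ← Real.exp_nat_mul, ← Real.exp_log (show (0 : ℝ) < 2 ^ l by positivity),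
        ← Real.exp_add, Real.log_pow]
      congr 1; ring
    have hu2 : κ * r * ρ ^ l ≤ u * 2 ^ l := by
      calc κ * r * ρ ^ l = κ * (r * Real.exp (Real.log r * (q * (l * Real.log 2)))) * 2 ^ l := by
            rw [hρl]; ring
        _ ≤ κ * r ^ K l * 2 ^ l := by gcongr
        _ ≤ u * 2 ^ l := by gcongr; exact hlow (K l)
    have hB1 : (2 : ℝ) ^ l ≤ (B l + 1) * (m * K l : ℕ) := by
      have : 2 ^ l < (B l + 1) * (m * K l) := Nat.lt_mul_of_div_lt (Nat.lt_succ_self _) hmK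
      exact_mod_cast this.le
    have hK1 : (K l : ℝ) ≤ q * (l * Real.log 2) + 1 := (Nat.ceil_lt_add_one (by positivity)).le
    have huB : (l : ℝ) ≤ u * B l := by
      have h1 : ((l : ℝ) + 1) * (m * K l : ℕ) ≤ (u * (B l + 1)) * (m * K l : ℕ) := by
        calc ((l : ℝ) + 1) * (m * K l : ℕ) ≤ ((l : ℝ) + 1) * (m * (q * (l * Real.log 2) + 1)) := by
              push_cast; gcongr
          _ ≤ u * 2 ^ l := hl.trans hu2
          _ ≤ u * ((B l + 1) * (m * K l : ℕ)) := by gcongr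
          _ = _ := by ring
      have h2 := le_of_mul_le_mul_right h1 (by exact_mod_cast hmK)
      linarith
    rw [← ofReal_measureReal]
    refine ENNReal.ofReal_le_ofReal ?_
    rw [hs, hX.real_forall_block_lt, ← hu, one_mul, ← Real.exp_nat_mul]
    calc (1 - u) ^ B l ≤ Real.exp (-u) ^ B l :=
          pow_le_pow_left₀ (by linarith) (by linarith [Real.add_one_le_exp (-u)]) _
      _ = Real.exp (B l * -u) := (Real.exp_nat_mul _ _).symm
      _ ≤ _ := Real.exp_le_exp.2 (by linarith)
  filter_upwards [ae_eventually_notMem_of_geometric (Real.exp_nonneg _)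
    (by rw [Real.exp_lt_one_iff]; norm_num) hbound] with ω hω
  filter_upwards [hω] with l hl
  simp only [hs, Set.mem_ofPred_eq, not_forall, not_lt] at hl
  obtain ⟨b, hb, hvis⟩ := hl
  set t := b * (m * K l) with ht
  -- This translate places the point `a` of the block picture at the walk's position `X t ω`.
  refine ⟨X t ω - a, (Nat.le_ceil _).trans ?_⟩
  have hfit : t + (m * K l) ≤ 2 ^ l := by
    calc t + m * K l = (b + 1) * (m * K l) := by rw [ht]; ring
      _ ≤ B l * (m * K l) := Nat.mul_le_mul_right _ hb
      _ ≤ 2 ^ l := Nat.div_mul_le_self _ _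
  have hcmp : visits A (fun i => a + (X (t + i) ω - X t ω)) (m * K l) ≤
      visits ((fun y => (X t ω - a) + y) '' A) (fun i => X i ω) (2 ^ l) := by
    refine le_trans ?_ (visits_mono _ _ hfit)
    rw [visits, visits, add_assoc, Finset.sum_range_add _ t]
    refine le_trans (Finset.sum_le_sum fun i _ => ?_) (Nat.le_add_left _ _)
    by_cases h : a + (X (t + i) ω - X t ω) ∈ A
    · rw [Set.indicator_of_mem h, Set.indicator_of_mem]
      exact ⟨_, h, by dsimp only; abel⟩
    · rw [Set.indicator_of_notMem h]; exact Nat.zero_le _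
  exact_mod_cast (Nat.le_succ _).trans (hvis.trans hcmp)

/-- The maximal occupation of translates of a finite set `A` is governed by the principal
eigenvalue `r` of the walk watched on `A`, exhibited through the eigenfunction `φ`. -/
theorem IsRandomWalk.tendsto_maxOccupationRatio (hX : IsRandomWalk X P) {A : Set (Fin d → ℤ)}
    (hA : A.Finite) (hne : A.Nonempty) {φ : (Fin d → ℤ) → ℝ} {C r : ℝ} (hr0 : 0 < r) (hr1 : r < 1)
    (h0 : ∀ x, 0 ≤ φ x) (hC : ∀ x, φ x ≤ C) (hpos : ∀ x ∈ A, 0 < φ x)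
    (hoff : ∀ x ∉ A, transition (P.map (X 1)) φ x = φ x)
    (hon : ∀ x ∈ A, transition (P.map (X 1)) φ x = r * φ x)
    (hdec : ∀ x, Tendsto (fun m => killedIterate (P.map (X 1)) A φ m x) atTop (𝓝 0)) :
    ∀ᵐ ω ∂P, Tendsto (maxOccupationRatio (fun n => X n ω) A) atTop (𝓝 (-1 / Real.log r)) := by
  have := hX.isProbabilityMeasure
  set ν := P.map (X 1) with hν
  have hL : Real.log r < 0 := Real.log_neg hr0 hr1
  obtain ⟨a, haA, ha⟩ := hA.exists_minimalFor φ A hne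
  have hmin : ∀ x ∈ A, φ a ≤ φ x := fun x hx =>
    (le_total (φ a) (φ x)).elim id fun h => ha hx h
  have hC0 : 0 < C := (hpos a haA).trans_le (hC a)
  have hupper : ∀ q : ℚ, -1 / Real.log r < q → ∀ᵐ ω ∂P, ∀ᶠ l : ℕ in atTop, ∀ z,
      (visits ((fun a => z + a) '' A) (fun i => X i ω) (2 ^ l) : ℝ) ≤ q * (l * Real.log 2) := by
    intro q hq
    refine hX.ae_eventually_visits_le hA hr0 hr1 (D := (φ a)⁻¹ * C) (fun n k y hy => ?_) hq
    refine (visitTail_le_of_supersolution h0 hC (hpos a haA) hr0.le hmin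
      (fun x hx => (hoff x hx).le) (fun x hx => (hon x hx).le) n y k).trans ?_
    have := hC y
    have := hpos a haA
    calc (φ a)⁻¹ * r ^ k * φ y ≤ (φ a)⁻¹ * r ^ k * C := by gcongr
      _ = _ := by ring
  have hlower : ∀ q : ℚ, 0 < (q : ℝ) → q < -1 / Real.log r → ∀ᵐ ω ∂P, ∀ᶠ l : ℕ in atTop, ∃ z,
      q * (l * Real.log 2) ≤ visits ((fun a => z + a) '' A) (fun i => X i ω) (2 ^ l) := by
    intro q hq0 hq
    -- The gap between `s` and `r` pays for discarding late returns, while `s` stays large enough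
    -- that `q < -1 / log s`.
    obtain ⟨s, hs1, hs2⟩ : ∃ s, Real.exp (-1 / q) < s ∧ s < r := by
      refine exists_between ?_
      rw [← Real.lt_log_iff_exp_lt hr0, div_lt_iff₀ hq0]
      rw [lt_div_iff_of_neg hL] at hq
      linarith
    have hs0 : 0 < s := (Real.exp_pos _).trans hs1
    have hsq : q < -1 / Real.log s := by
      rw [lt_div_iff_of_neg (Real.log_neg hs0 (hs2.trans hr1))]
      rw [← Real.lt_log_iff_exp_lt hs0, div_lt_iff₀ hq0] at hs1
      linarith
    have hlim : ∀ x ∈ A, ∀ᶠ m in atTop,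
        s * φ x ≤ transition ν (fun y => φ y - killedIterate ν A φ m y) x := by
      intro x hx
      have ht := tendsto_transition (ν := ν) (f := fun m y => φ y - killedIterate ν A φ m y)
        (g := φ) (C := C) (fun m y => sub_nonneg.2 (killedIterate_le h0 hC hoff m y))
        (fun m y => (sub_le_self _ (killedIterate_nonneg h0 m y)).trans (hC y))
        (fun y => by simpa using (hdec y).const_sub (φ y)) x
      rw [hon x hx] at ht
      exact (ht.eventually_const_lt (mul_lt_mul_of_pos_right hs2 (hpos x hx))).mono
        fun _ h => h.le
    -- Finiteness of `A` gives one return window `m` valid for every starting point in `A`.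
    obtain ⟨m, hm⟩ := ((eventually_all_finite hA).2 hlim).exists
    refine hX.ae_eventually_le_visits (A := A) (a := a) (κ := C⁻¹ * φ a) (m := m + 1) hs0
      (hs2.trans hr1) (mul_pos (inv_pos.2 hC0) (hpos a haA)) (fun k => ?_) hq0 hsq m.succ_pos
    refine le_trans (le_of_eq ?_)
      (le_visitTail_of_subsolution h0 hC hC0 hs0.le hoff hm haA k)
    ring
  have hU := ae_all_iff.2 fun q : ℚ => ae_all_iff.2 (hupper q)
  have hL' := ae_all_iff.2 fun q : ℚ => ae_all_iff.2 fun h => ae_all_iff.2 (hlower q h)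
  filter_upwards [hU, hL'] with ω hω1 hω2
  exact tendsto_maxOccupationRatio_of_dyadic (div_pos_of_neg_of_neg (by norm_num) hL) hω1 hω2

end Limit

/-! ### Part (a): the two-point set. -/

section Pair

variable {d : ℕ} {Ω : Type*} [MeasurableSpace Ω] {P : Measure Ω} [IsProbabilityMeasure P]
  {X : ℕ → Ω → (Fin d → ℤ)}

/-- A law on a countable group has an atom `z`. By symmetry `-z` is an atom too, so a step to `z`
followed by a step back returns to `0` with positive probability. This keeps the eigenvalue
positive. -/
theorem transition_hitting_zero_pos {E : Type*} [AddCommGroup E] [Countable E] [MeasurableSpace E]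
    [DiscreteMeasurableSpace E] {ν : Measure E} [IsProbabilityMeasure ν]
    (hν : ν.map Neg.neg = ν) : 0 < transition ν (hitting ν) 0 := by
  refine (transition_nonneg hitting_nonneg 0).lt_of_ne' fun h => ?_
  rw [transition, integral_eq_zero_iff_of_nonneg (fun z => hitting_nonneg _)
    (integrable_of_bounds hitting_nonneg hitting_le_one 0)] at h
  have hall := (ae_iff_of_countable (μ := ν)).1 h
  have hnull : ∀ z, ν {z} ≠ 0 → False := by
    intro z hz
    have hz0 : hitting ν z = 0 := by simpa using hall z hz
    rcases eq_or_ne z 0 with rfl | hne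
    · rw [hitting_zero] at hz0; exact one_ne_zero hz0
    · have hneg : ν {-z} = ν {z} := by
        conv_rhs => rw [← hν, Measure.map_apply Measurable.of_discrete MeasurableSet.of_discrete]
        congr 1; ext w; simp [eq_neg_iff_add_eq_zero]
      have hle := real_singleton_neg_le_hitting (ν := ν) hne
      rw [hz0, Measure.real, hneg] at hle
      exact absurd (ENNReal.toReal_pos hz (measure_ne_top _ _)) (not_lt.2 hle)
  have hfalse : ∀ᵐ _z ∂ν, False := (ae_iff_of_countable (μ := ν)).2 hnull
  exact hfalse.exists.elim fun _ h => h

/-- By symmetry the pair potential equals `1 + t` at both points, with `t` the hitting probability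
of `y`. One step from either point replaces the summand `1` by `1 - γ` and leaves `t` unchanged, so
the eigenvalue is `(1 + t - γ) / (1 + t)`. -/
theorem IsRandomWalk.tendsto_maxOccupationRatio_pair (hX : IsRandomWalk X P)
    (hsymm : IsSymmetric X P) (htrans : IsTransient X P) {y : Fin d → ℤ} (hy : y ≠ 0) :
    ∀ᵐ ω ∂P, Tendsto (maxOccupationRatio (fun n => X n ω) {0, y}) atTop
      (𝓝 (-1 / Real.log (1 - noReturnProb X P / (1 + hitProb X P y)))) := by
  have := hX.isProbabilityMeasure
  set ν := P.map (X 1) with hν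
  have hneg : ν.map Neg.neg = ν := by
    rw [hν, Measure.map_map Measurable.of_discrete (hX.measurable 1)]
    exact hsymm.map_eq.symm
  have ht : hitProb X P y = hitting ν y := by rw [hX.hitProb_eq hy, hitting_neg hneg]
  have hγ : transition ν (hitting ν) 0 = 1 - noReturnProb X P := by
    rw [hX.noReturnProb_eq]; ring
  have hγ0 : 0 < noReturnProb X P := htrans
  have hγ1 : noReturnProb X P < 1 := by
    have := transition_hitting_zero_pos hneg
    linarith
  rw [ht]
  have ht0 : 0 ≤ hitting ν y := hitting_nonneg y
  have h1t : 0 < 1 + hitting ν y := by linarith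
  have hmul : (1 - noReturnProb X P / (1 + hitting ν y)) * (1 + hitting ν y) =
      1 + hitting ν y - noReturnProb X P := by field_simp
  have hval0 : pairPotential ν y 0 = 1 + hitting ν y := by
    rw [pairPotential, hitting_zero, zero_sub, hitting_neg hneg]
  have hvaly : pairPotential ν y y = 1 + hitting ν y := by
    rw [pairPotential, sub_self, hitting_zero, add_comm]
  refine hX.tendsto_maxOccupationRatio (Set.toFinite _) ⟨0, by simp⟩ (C := 2) ?_ ?_
    (pairPotential_nonneg y) (pairPotential_le_two y) ?_ ?_ ?_
    (tendsto_killedIterate_pairPotential y)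
  · rw [sub_pos, div_lt_one h1t]; linarith
  · have : 0 < noReturnProb X P / (1 + hitting ν y) := div_pos hγ0 h1t
    linarith
  · rintro x (rfl | rfl)
    · rw [hval0]; exact h1t
    · rw [hvaly]; exact h1t
  · intro x hx
    simp only [Set.mem_insert_iff, Set.mem_singleton_iff, not_or] at hx
    rw [transition_pairPotential, transition_hitting hx.1,
      transition_hitting (sub_ne_zero.2 hx.2), pairPotential]
  · rintro x (rfl | rfl)
    · rw [transition_pairPotential, zero_sub, transition_hitting (neg_ne_zero.2 hy), hγ, hval0,
        hmul, hitting_neg hneg]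
      ring
    · rw [transition_pairPotential, sub_self, transition_hitting hy, hγ, hvaly, hmul]
      ring

end Pair

/-! ### Steps and transience of the simple random walk. -/

section Simple

variable {d : ℕ}

/-- The signed unit vectors `± e_i`. -/
def unitVec (p : Fin d × Bool) : Fin d → ℤ := if p.2 then Pi.single p.1 1 else -Pi.single p.1 1

theorem unitVec_true (i : Fin d) : unitVec (i, true) = Pi.single i 1 := rfl

theorem unitVec_false (i : Fin d) : unitVec (i, false) = -Pi.single i 1 := rfl

theorem unitVec_not (p : Fin d × Bool) : unitVec (p.1, !p.2) = -unitVec p := by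
  rcases p with ⟨i, b | b⟩ <;> simp [unitVec]

theorem unitVec_ne_zero (p : Fin d × Bool) : unitVec p ≠ 0 := by
  intro h
  have := congrFun h p.1
  rcases p with ⟨i, b | b⟩ <;> simp [unitVec] at this

theorem unitVec_injective : Function.Injective (unitVec (d := d)) := by
  rintro ⟨i, b⟩ ⟨j, c⟩ h
  have hij : i = j := by
    by_contra hne
    have := congrFun h i
    cases b <;> cases c <;> simp [unitVec, hne] at this
  subst hij
  have := congrFun h i
  cases b <;> cases c <;> simp [unitVec] at this ⊢

theorem range_unitVec : Set.range (unitVec (d := d)) = unitSphere d := by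
  ext x
  constructor
  · rintro ⟨⟨i, b | b⟩, rfl⟩
    exacts [⟨i, Or.inr rfl⟩, ⟨i, Or.inl rfl⟩]
  · rintro ⟨i, rfl | rfl⟩
    exacts [⟨(i, true), rfl⟩, ⟨(i, false), rfl⟩]

theorem unitVec_mem (p : Fin d × Bool) : unitVec p ∈ unitSphere d :=
  range_unitVec ▸ Set.mem_range_self p

theorem zero_notMem_unitSphere : (0 : Fin d → ℤ) ∉ unitSphere d := by
  rw [← range_unitVec]; rintro ⟨p, hp⟩; exact unitVec_ne_zero p hp

theorem add_unitVec_eq_zero_iff {x : Fin d → ℤ} {p : Fin d × Bool} :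
    x + unitVec p = 0 ↔ x = unitVec (p.1, !p.2) := by
  rw [unitVec_not, add_eq_zero_iff_eq_neg]

theorem finite_unitSphere : (unitSphere d).Finite := range_unitVec (d := d) ▸ Set.finite_range _

theorem finite_unitBall : (unitBall d).Finite := finite_unitSphere.insert 0

variable {ν : Measure (Fin d → ℤ)} [IsProbabilityMeasure ν]

/-- The `2d` prescribed masses add up to one, so the step law is carried by the unit vectors. -/
theorem transition_simple (hd : 0 < d)
    (hν : ∀ x ∈ unitSphere d, ν.real {x} = 1 / (2 * (d : ℝ))) (f : (Fin d → ℤ) → ℝ)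
    (x : Fin d → ℤ) :
    transition ν f x = (2 * (d : ℝ))⁻¹ * ∑ p : Fin d × Bool, f (x + unitVec p) := by
  classical
  have hd' : (0 : ℝ) < d := by exact_mod_cast hd
  set F : Finset (Fin d → ℤ) := Finset.univ.map ⟨unitVec, unitVec_injective⟩ with hF
  have hFν : ν.real F = 1 := by
    rw [← sum_measureReal_singleton, hF, Finset.sum_map]
    simp only [Function.Embedding.coeFn_mk, hν _ (unitVec_mem _)]
    simp only [Finset.sum_const, Finset.card_univ, Fintype.card_prod, Fintype.card_fin,
      Fintype.card_bool, nsmul_eq_mul]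
    push_cast
    field_simp
  have hFae : ∀ᵐ z ∂ν, z ∈ (F : Set (Fin d → ℤ)) := by
    refine (mem_ae_iff_prob_eq_one MeasurableSet.of_discrete).2 ?_
    change ν (F : Set (Fin d → ℤ)) = 1
    rw [← ofReal_measureReal, hFν, ENNReal.ofReal_one]
  have hres : ν.restrict F = ν := Measure.restrict_eq_self_of_ae_mem hFae
  have h := setIntegral_finset (μ := ν) (f := fun z => f (x + z)) F IntegrableOn.finset
  rw [hres] at h
  rw [transition, h, hF, Finset.sum_map, Finset.mul_sum]
  refine Finset.sum_congr rfl fun p _ => ?_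
  simp [hν _ (unitVec_mem _)]

/-- The squared Euclidean norm. -/
noncomputable def sqNorm (x : Fin d → ℤ) : ℝ := ∑ i, (x i : ℝ) ^ 2

theorem sqNorm_add_unitVec (x : Fin d → ℤ) (p : Fin d × Bool) :
    sqNorm (x + unitVec p) = sqNorm x + (1 + (if p.2 then 2 else -2) * x p.1) := by
  rcases p with ⟨i, b⟩
  have h : ∀ j, ((x + unitVec (i, b)) j : ℝ) ^ 2 = (x j : ℝ) ^ 2 +
      if j = i then 1 + (if b then 2 else -2) * (x i : ℝ) else 0 := by
    intro j
    by_cases hj : j = i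
    · subst hj
      cases b <;> simp [unitVec] <;> ring
    · cases b <;> simp [unitVec, hj]
  simp only [sqNorm, h, Finset.sum_add_distrib, Finset.sum_ite_eq', Finset.mem_univ, if_true]

/-- The Taylor coefficient of `s ^ 2` is `5 / 32`; taking `3 / 16` leaves room for the higher-order
terms when `|s| ≤ 1 / 30`. After taking fourth powers the claim is polynomial. -/
theorem rpow_neg_quarter_le {s : ℝ} (h1 : -(1 / 30) ≤ s) (h2 : s ≤ 1 / 30) :
    (1 + s) ^ (-(1 / 4) : ℝ) ≤ 1 - s / 4 + 3 / 16 * s ^ 2 := by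
  have hs : 0 < 1 + s := by linarith
  set w := 1 - s / 4 + 3 / 16 * s ^ 2 with hw
  have hw0 : 0 ≤ w := by rw [hw]; nlinarith [sq_nonneg s]
  have hw2 : 1 - s / 2 + 7 / 16 * s ^ 2 - 3 / 32 * s ^ 3 ≤ w ^ 2 := by
    have : w ^ 2 = 1 - s / 2 + 7 / 16 * s ^ 2 - 3 / 32 * s ^ 3 + 9 / 256 * (s ^ 2) ^ 2 := by
      rw [hw]; ring
    rw [this]; linarith [mul_nonneg (by norm_num : (0 : ℝ) ≤ 9 / 256) (sq_nonneg (s ^ 2))]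
  -- Replacing `w ^ 2` by its cubic truncation `v` keeps the polynomial of low degree.
  have hkey : 1 ≤ (1 + s) * (w ^ 2) ^ 2 := by
    set v := 1 - s / 2 + 7 / 16 * s ^ 2 - 3 / 32 * s ^ 3 with hv
    have hv0 : 0 ≤ v := by
      rw [hv]; nlinarith [sq_nonneg s, mul_nonneg (sq_nonneg s) (by linarith : (0 : ℝ) ≤ 1 / 30 - s)]
    have hv2 : 1 ≤ (1 + s) * v ^ 2 := by
      have ht0 : 0 ≤ s ^ 2 := sq_nonneg s
      have ht1 : s ^ 2 ≤ 1 / 900 := by nlinarith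
      have hQ0 : 0 ≤ 1 / 2 + 13 / 64 * s ^ 2 + 9 / 1024 * (s ^ 2) ^ 2 := by positivity
      have hQ1 : 1 / 2 + 13 / 64 * s ^ 2 + 9 / 1024 * (s ^ 2) ^ 2 ≤ 1 := by nlinarith
      have hexp : (1 + s) * v ^ 2 = 1 + s ^ 2 * (1 / 8 +
          s * (1 / 2 + 13 / 64 * s ^ 2 + 9 / 1024 * (s ^ 2) ^ 2) - 87 / 256 * s ^ 2 -
          75 / 1024 * (s ^ 2) ^ 2) := by
        rw [hv]; ring
      rw [hexp, le_add_iff_nonneg_right]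
      refine mul_nonneg ht0 ?_
      have hsQ : -(1 / 30) ≤ s * (1 / 2 + 13 / 64 * s ^ 2 + 9 / 1024 * (s ^ 2) ^ 2) := by
        nlinarith [mul_nonneg (by linarith : 0 ≤ s + 1 / 30) hQ0]
      nlinarith
    exact hv2.trans (mul_le_mul_of_nonneg_left (pow_le_pow_left₀ hv0 hw2 2) hs.le)
  have hinv : (1 + s)⁻¹ ≤ w ^ 4 := by
    rw [inv_le_iff_one_le_mul₀ hs]
    linarith [hkey, show (w ^ 2) ^ 2 * (1 + s) = w ^ 4 * (1 + s) by ring]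
  calc (1 + s) ^ (-(1 / 4) : ℝ) = ((1 + s)⁻¹) ^ ((4 : ℕ) : ℝ)⁻¹ := by
        rw [Real.inv_rpow hs.le, ← Real.rpow_neg hs.le]; norm_num
    _ ≤ (w ^ 4) ^ ((4 : ℕ) : ℝ)⁻¹ := Real.rpow_le_rpow (inv_nonneg.2 hs.le) hinv (by norm_num)
    _ = w := Real.pow_rpow_inv_natCast hw0 (by norm_num)

/-- A superharmonic function for the simple random walk in dimension at least three. -/
noncomputable def lyapunov (x : Fin d → ℤ) : ℝ := (sqNorm x + 1200) ^ (-(1 / 4) : ℝ)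

theorem sqNorm_nonneg (x : Fin d → ℤ) : 0 ≤ sqNorm x :=
  Finset.sum_nonneg fun _ _ => sq_nonneg _

theorem lyapunov_pos (x : Fin d → ℤ) : 0 < lyapunov x :=
  Real.rpow_pos_of_pos (by linarith [sqNorm_nonneg x]) _

theorem lyapunov_le_one (x : Fin d → ℤ) : lyapunov x ≤ 1 :=
  Real.rpow_le_one_of_one_le_of_nonpos (by linarith [sqNorm_nonneg x]) (by norm_num)

theorem transition_lyapunov_le (hd : 3 ≤ d)
    (hν : ∀ x ∈ unitSphere d, ν.real {x} = 1 / (2 * (d : ℝ))) (x : Fin d → ℤ) :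
    transition ν lyapunov x ≤ lyapunov x := by
  have hd' : (3 : ℝ) ≤ d := by exact_mod_cast hd
  rw [transition_simple (by omega) hν]
  set R := sqNorm x + 1200 with hR
  have hN := sqNorm_nonneg x
  have hR0 : 0 < R := by linarith
  -- The relative change of `sqNorm x + 1200` along a step. The shift `1200` guarantees `|s| ≤ 1 /
  -- 30`, since `60 * |x i| ≤ x i ^ 2 + 900`.
  set s : Fin d × Bool → ℝ := fun p => (1 + (if p.2 then 2 else -2) * x p.1) / R with hs
  have hx : ∀ i, (x i : ℝ) ^ 2 ≤ sqNorm x := fun i =>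
    Finset.single_le_sum (f := fun i => (x i : ℝ) ^ 2) (fun _ _ => sq_nonneg _)
      (Finset.mem_univ i)
  have hterm : ∀ p, lyapunov (x + unitVec p) ≤
      lyapunov x * (1 - s p / 4 + 3 / 16 * s p ^ 2) := by
    intro p
    have h1 : -(1 / 30) ≤ s p := by
      rw [hs, le_div_iff₀ hR0]
      have := hx p.1
      rcases p with ⟨i, b⟩
      cases b <;> simp <;> nlinarith [sq_nonneg ((x i : ℝ) - 30), sq_nonneg ((x i : ℝ) + 30)]
    have h2 : s p ≤ 1 / 30 := by
      rw [hs, div_le_iff₀ hR0]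
      have := hx p.1
      rcases p with ⟨i, b⟩
      cases b <;> simp <;> nlinarith [sq_nonneg ((x i : ℝ) - 30), sq_nonneg ((x i : ℝ) + 30)]
    have h3 : sqNorm (x + unitVec p) + 1200 = R * (1 + s p) := by
      rw [sqNorm_add_unitVec, hs]; field_simp; rw [hR]; ring
    rw [lyapunov, h3, Real.mul_rpow hR0.le (by linarith)]
    exact mul_le_mul_of_nonneg_left (rpow_neg_quarter_le h1 h2) (lyapunov_pos x).le
  -- In opposite directions the terms of `s` linear in `x i` cancel, leaving a negative drift of
  -- order `1 / R` against a second-order term.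
  have hsum : ∑ p, (1 - s p / 4 + 3 / 16 * s p ^ 2) ≤ 2 * (d : ℝ) := by
    have h1 : ∀ i, (1 - s (i, true) / 4 + 3 / 16 * s (i, true) ^ 2) +
        (1 - s (i, false) / 4 + 3 / 16 * s (i, false) ^ 2) =
        2 - 1 / (2 * R) + (3 / 8) / R ^ 2 + (3 / 2) / R ^ 2 * (x i : ℝ) ^ 2 := by
      intro i
      simp only [hs, if_true, Bool.false_eq_true, if_false]
      field_simp
      ring
    rw [Fintype.sum_prod_type]
    rw [Finset.sum_congr rfl fun i _ => (Fintype.sum_bool _).trans (h1 i)]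
    rw [Finset.sum_add_distrib, ← Finset.mul_sum, Finset.sum_const, Finset.card_univ,
      Fintype.card_fin, nsmul_eq_mul]
    change d * (2 - 1 / (2 * R) + 3 / 8 / R ^ 2) + 3 / 2 / R ^ 2 * sqNorm x ≤ 2 * d
    have h2 : 2 * d - (d * (2 - 1 / (2 * R) + 3 / 8 / R ^ 2) + 3 / 2 / R ^ 2 * sqNorm x) =
        (4 * d * R - 3 * d - 12 * sqNorm x) / (8 * R ^ 2) := by
      field_simp; ring
    -- Here the dimension enters: `4 * d ≥ 12` is what lets `4 * d * R` dominate `12 * sqNorm x`.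
    have h3 : 0 ≤ (4 * d * R - 3 * d - 12 * sqNorm x) / (8 * R ^ 2) := by
      refine div_nonneg ?_ (by positivity)
      rw [hR]; nlinarith
    linarith
  calc (2 * (d : ℝ))⁻¹ * ∑ p, lyapunov (x + unitVec p)
      ≤ (2 * (d : ℝ))⁻¹ * ∑ p, lyapunov x * (1 - s p / 4 + 3 / 16 * s p ^ 2) :=
        mul_le_mul_of_nonneg_left (Finset.sum_le_sum fun p _ => hterm p) (by positivity)
    _ = (2 * (d : ℝ))⁻¹ * (lyapunov x * ∑ p, (1 - s p / 4 + 3 / 16 * s p ^ 2)) := by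
        rw [← Finset.mul_sum]
    _ ≤ (2 * (d : ℝ))⁻¹ * (lyapunov x * (2 * d)) := by
        have := lyapunov_pos x
        gcongr
    _ = lyapunov x := by field_simp

/-- Transience of the simple random walk in dimension at least three. -/
theorem hitting_unitVec_lt_one (hd : 3 ≤ d)
    (hν : ∀ x ∈ unitSphere d, ν.real {x} = 1 / (2 * (d : ℝ))) (p : Fin d × Bool) :
    hitting ν (unitVec p) < 1 := by
  have hle : hitting ν (unitVec p) ≤ (lyapunov (0 : Fin d → ℤ))⁻¹ * lyapunov (unitVec p) := by
    refine le_of_tendsto' (tendsto_hitting _) fun m => ?_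
    -- With `r = 1` and `k = 0` the supersolution bound is the maximum principle for hitting the
    -- origin.
    have := visitTail_le_of_supersolution (ν := ν) (A := {0}) (φ := lyapunov) (r := 1)
      (fun x => (lyapunov_pos x).le) lyapunov_le_one (lyapunov_pos 0) zero_le_one
      (fun x hx => by rw [Set.mem_singleton_iff.1 hx])
      (fun x _ => transition_lyapunov_le hd hν x)
      (fun x _ => by rw [one_mul]; exact transition_lyapunov_le hd hν x) m (unitVec p) 0
    simpa using this
  refine hle.trans_lt ?_
  rw [inv_mul_lt_one₀ (lyapunov_pos 0), lyapunov, lyapunov]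
  have h0 : sqNorm (0 : Fin d → ℤ) = 0 := by simp [sqNorm]
  have h1 : sqNorm (unitVec p) = 1 := by
    have := sqNorm_add_unitVec 0 p
    rw [zero_add, h0] at this
    simpa using this
  rw [h0, h1]
  exact Real.rpow_lt_rpow_of_neg (by norm_num) (by norm_num) (by norm_num)

end Simple

/-! ### Part (b): the unit sphere and the unit ball. -/

section SimpleOccupation

set_option linter.unusedSectionVars false

variable {d : ℕ} {ν : Measure (Fin d → ℤ)} [IsProbabilityMeasure ν]

/-- Negation and coordinate swaps preserve the step law, and together they act transitively on the
neighbours of the origin. -/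
theorem hitting_unitVec_eq (hd : 0 < d)
    (hν : ∀ x ∈ unitSphere d, ν.real {x} = 1 / (2 * (d : ℝ))) (p q : Fin d × Bool) :
    hitting ν (unitVec p) = hitting ν (unitVec q) := by
  have hneg : ∀ x, hitting ν (-x) = hitting ν x := fun x => by
    refine hitting_comp (fun x => neg_eq_zero) (fun f x => ?_) x
    rw [transition_simple hd hν, transition_simple hd hν]
    congr 1
    refine Fintype.sum_equiv ((Equiv.refl _).prodCongr Equiv.boolNot) _ _ fun p => ?_
    have := unitVec_not p
    simp only [Equiv.prodCongr_apply, Prod.map, Equiv.refl_apply, Equiv.boolNot_apply, this]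
    congr 1; abel
  have hpos : ∀ p : Fin d × Bool, hitting ν (unitVec p) = hitting ν (unitVec (p.1, true)) := by
    rintro ⟨i, b | b⟩
    · rw [unitVec_false, hneg, unitVec_true]
    · rfl
  rw [hpos p, hpos q]
  set π := Equiv.swap p.1 q.1 with hπ
  have hvec : ∀ r : Fin d × Bool, unitVec r ∘ π = unitVec (π r.1, r.2) := by
    rintro ⟨i, b⟩
    funext k
    have : π k = i ↔ k = π i := by rw [hπ, Equiv.swap_apply_eq_iff]
    cases b <;> simp [unitVec, Pi.single_apply, this]
  have hswap := hitting_comp (ν := ν) (σ := fun x => x ∘ π)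
    (fun x => ⟨fun h => funext fun k => by simpa using congrFun h (π.symm k),
      fun h => by rw [h]; rfl⟩) (fun f x => by
    rw [transition_simple hd hν, transition_simple hd hν]
    congr 1
    refine Fintype.sum_equiv (π.prodCongr (Equiv.refl _)) _ _ fun r => ?_
    have h1 : (x + unitVec ((π.prodCongr (Equiv.refl _)) r)) ∘ π = x ∘ π + unitVec r := by
      have h2 : (π (π r.1), r.2) = r := Prod.ext (Equiv.swap_apply_eq_iff.2 rfl) rfl
      have h3 := hvec (π r.1, r.2)
      rw [h2] at h3
      rw [← h3]; rfl
    rw [h1]) (unitVec (p.1, true))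
  rw [← hswap]
  rw [hvec, hπ]
  simp only [Equiv.swap_apply_left]

/-- The multiple `c` of the hitting probability of the origin, with the value at the origin
replaced by `1`. -/
noncomputable def scaledHitting (ν : Measure (Fin d → ℤ)) (c : ℝ) (x : Fin d → ℤ) : ℝ :=
  if x = 0 then 1 else c * hitting ν x

theorem scaledHitting_zero (c : ℝ) : scaledHitting ν c 0 = 1 := if_pos rfl

theorem scaledHitting_of_ne {x : Fin d → ℤ} (hx : x ≠ 0) (c : ℝ) :
    scaledHitting ν c x = c * hitting ν x := if_neg hx

theorem scaledHitting_nonneg {c : ℝ} (hc : 0 ≤ c) (x : Fin d → ℤ) : 0 ≤ scaledHitting ν c x := by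
  unfold scaledHitting
  split_ifs
  · exact zero_le_one
  · exact mul_nonneg hc (hitting_nonneg x)

theorem scaledHitting_le (c : ℝ) (x : Fin d → ℤ) :
    scaledHitting ν c x ≤ max 1 c * hitting ν x := by
  unfold scaledHitting
  split_ifs with h
  · rw [h, hitting_zero, mul_one]; exact le_max_left _ _
  · exact mul_le_mul_of_nonneg_right (le_max_right _ _) (hitting_nonneg x)

theorem mul_hitting_le {C : ℝ} (hC : 0 ≤ C) (x : Fin d → ℤ) : C * hitting ν x ≤ C :=
  mul_le_of_le_one_right hC (hitting_le_one x)

theorem max_one_nonneg (c : ℝ) : 0 ≤ max 1 c := zero_le_one.trans (le_max_left _ _)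

theorem transition_scaledHitting_zero (hd : 0 < d)
    (hν : ∀ x ∈ unitSphere d, ν.real {x} = 1 / (2 * (d : ℝ))) (c : ℝ) :
    transition ν (scaledHitting ν c) 0 = c * transition ν (hitting ν) 0 := by
  rw [← transition_const_mul, transition_simple hd hν, transition_simple hd hν]
  congr 1
  exact Finset.sum_congr rfl fun p _ => by
    rw [zero_add, scaledHitting_of_ne (unitVec_ne_zero p)]

/-- Exactly one neighbour of a unit vector is the origin; resetting its value from `c` to `1`
changes the average by `(1 - c) / (2 * d)`. -/
theorem transition_scaledHitting_unitVec (hd : 0 < d)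
    (hν : ∀ x ∈ unitSphere d, ν.real {x} = 1 / (2 * (d : ℝ))) (c : ℝ) (p : Fin d × Bool) :
    transition ν (scaledHitting ν c) (unitVec p) =
      c * hitting ν (unitVec p) + (1 - c) / (2 * d) := by
  have h : ∀ q : Fin d × Bool, scaledHitting ν c (unitVec p + unitVec q) =
      c * hitting ν (unitVec p + unitVec q) + if q = (p.1, !p.2) then 1 - c else 0 := by
    intro q
    have hiff : unitVec p + unitVec q = 0 ↔ q = (p.1, !p.2) := by
      rw [add_comm, add_unitVec_eq_zero_iff, unitVec_injective.eq_iff]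
    by_cases hq : q = (p.1, !p.2)
    · rw [if_pos hq, hiff.2 hq, scaledHitting_zero, hitting_zero]; ring
    · rw [if_neg hq, scaledHitting_of_ne (mt hiff.1 hq), add_zero]
  rw [transition_simple hd hν]
  simp only [h]
  rw [Finset.sum_add_distrib, Finset.sum_ite_eq' Finset.univ, if_pos (Finset.mem_univ _), mul_add,
    ← transition_simple hd hν (fun y => c * hitting ν y), transition_const_mul,
    transition_hitting (unitVec_ne_zero p)]
  ring

theorem add_unitVec_ne_zero {x : Fin d → ℤ} (hx : x ∉ unitSphere d) (p : Fin d × Bool) :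
    x + unitVec p ≠ 0 := fun h => hx (add_unitVec_eq_zero_iff.1 h ▸ unitVec_mem _)

theorem transition_scaledHitting_of_notMem (hd : 0 < d)
    (hν : ∀ x ∈ unitSphere d, ν.real {x} = 1 / (2 * (d : ℝ))) (c : ℝ) {x : Fin d → ℤ}
    (hx0 : x ≠ 0) (hx : x ∉ unitSphere d) :
    transition ν (scaledHitting ν c) x = scaledHitting ν c x := by
  rw [scaledHitting_of_ne hx0, ← transition_hitting hx0, ← transition_const_mul,
    transition_simple hd hν, transition_simple hd hν]
  congr 1
  exact Finset.sum_congr rfl fun p _ => scaledHitting_of_ne (add_unitVec_ne_zero hx p) c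

theorem tendsto_const_mul_killedIterate_hitting (C : ℝ) (x : Fin d → ℤ) :
    Tendsto (fun m => C * killedIterate ν {0} (hitting ν) m x) atTop (𝓝 0) := by
  simpa using (tendsto_killedIterate_hitting (ν := ν) x).const_mul C

theorem tendsto_killedIterate_unitBall {c : ℝ} (hc : 0 ≤ c) (x : Fin d → ℤ) :
    Tendsto (fun m => killedIterate ν (unitBall d) (scaledHitting ν c) m x) atTop (𝓝 0) := by
  refine squeeze_zero (killedIterate_nonneg (scaledHitting_nonneg hc) · x) (fun m => ?_)
    (tendsto_const_mul_killedIterate_hitting (ν := ν) (max 1 c) x)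
  rw [← killedIterate_const_mul]
  refine killedIterate_mono (C := max 1 c) (by simp [unitBall]) (scaledHitting_nonneg hc)
    (scaledHitting_le c) (mul_hitting_le (max_one_nonneg c)) (fun z hz => ?_) m x
  rw [transition_const_mul, transition_hitting (by simpa using hz)]

/-- The sphere does not contain `0`, so monotonicity in the killing set is not available. Instead,
nearest-neighbour steps cannot reach `0` from outside without meeting the sphere, so off `0` the
comparison with killing at `0` survives each step. -/
theorem tendsto_killedIterate_unitSphere (hd : 0 < d)
    (hν : ∀ x ∈ unitSphere d, ν.real {x} = 1 / (2 * (d : ℝ))) {c : ℝ} (hc : 0 ≤ c)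
    (x : Fin d → ℤ) :
    Tendsto (fun m => killedIterate ν (unitSphere d) (scaledHitting ν c) m x) atTop (𝓝 0) := by
  have hle : ∀ m, ∀ x ≠ 0, killedIterate ν (unitSphere d) (scaledHitting ν c) m x ≤
      max 1 c * killedIterate ν {0} (hitting ν) m x := by
    intro m
    induction m with
    | zero =>
      intro x hx0
      by_cases hx : x ∈ unitSphere d
      · rw [killedIterate_of_mem hx]
        exact mul_nonneg (max_one_nonneg c) (killedIterate_nonneg hitting_nonneg _ _)
      · rw [killedIterate_zero_of_notMem hx,
          killedIterate_zero_of_notMem (A := {0}) (by simpa using hx0)]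
        exact scaledHitting_le c x
    | succ m ih =>
      intro x hx0
      by_cases hx : x ∈ unitSphere d
      · rw [killedIterate_of_mem hx]
        exact mul_nonneg (max_one_nonneg c) (killedIterate_nonneg hitting_nonneg _ _)
      · rw [killedIterate_succ_of_notMem hx,
          killedIterate_succ_of_notMem (A := {0}) (by simpa using hx0), ← transition_const_mul,
          transition_simple hd hν, transition_simple hd hν]
        exact mul_le_mul_of_nonneg_left
          (Finset.sum_le_sum fun p _ => ih _ (add_unitVec_ne_zero hx p)) (by positivity)
  rcases eq_or_ne x 0 with rfl | hx0
  · refine (tendsto_add_atTop_iff_nat 1).1 (tendsto_const_nhds.congr fun m => ?_)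
    rw [killedIterate_succ_of_notMem zero_notMem_unitSphere, transition_simple hd hν,
      Finset.sum_eq_zero, mul_zero]
    intro p _
    rw [zero_add, killedIterate_of_mem (unitVec_mem p)]
  · exact squeeze_zero (killedIterate_nonneg (scaledHitting_nonneg hc) · x) (fun m => hle m x hx0)
      (tendsto_const_mul_killedIterate_hitting (max 1 c) x)

variable {Ω : Type*} [MeasurableSpace Ω] {P : Measure Ω} [IsProbabilityMeasure P]
  {X : ℕ → Ω → (Fin d → ℤ)}

theorem IsRandomWalk.map_real_unitSphere (hX : IsRandomWalk X P) (hs : IsSimple X P) :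
    ∀ x ∈ unitSphere d, (P.map (X 1)).real {x} = 1 / (2 * (d : ℝ)) := fun x hx => by
  rw [map_measureReal_apply (hX.measurable 1) (measurableSet_singleton x), ← hs x hx]
  rfl

/-- For the simple random walk, the return probability lies in `[1/(2d), 1)` and is the probability
to hit the origin from any of its neighbours. -/
theorem IsRandomWalk.one_sub_noReturnProb (hX : IsRandomWalk X P) (hs : IsSimple X P)
    (hd : 3 ≤ d) :
    (transition (P.map (X 1)) (hitting (P.map (X 1))) 0 = 1 - noReturnProb X P) ∧
    (∀ p, hitting (P.map (X 1)) (unitVec p) = 1 - noReturnProb X P) ∧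
    1 / (2 * (d : ℝ)) ≤ 1 - noReturnProb X P ∧ 1 - noReturnProb X P < 1 := by
  have := hX.isProbabilityMeasure
  have hν := hX.map_real_unitSphere hs
  have hd0 : 0 < d := by omega
  have hd' : (0 : ℝ) < d := by exact_mod_cast hd0
  set ν := P.map (X 1)
  have hγ : transition ν (hitting ν) 0 = 1 - noReturnProb X P := by
    rw [hX.noReturnProb_eq]; ring
  have hall : ∀ p, hitting ν (unitVec p) = 1 - noReturnProb X P := by
    intro p
    rw [← hγ, transition_simple hd0 hν]
    simp only [zero_add]
    rw [Finset.sum_congr rfl fun q _ => hitting_unitVec_eq hd0 hν q p]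
    simp only [Finset.sum_const, Finset.card_univ, Fintype.card_prod, Fintype.card_fin,
      Fintype.card_bool, nsmul_eq_mul]
    push_cast
    field_simp
  refine ⟨hγ, hall, ?_, ?_⟩
  · rw [← hall (⟨0, hd0⟩, true), ← hν _ (unitVec_mem (⟨0, hd0⟩, false))]
    have h := real_singleton_neg_le_hitting (ν := ν) (unitVec_ne_zero (⟨0, hd0⟩, true))
    rwa [← unitVec_not] at h
  · rw [← hall (⟨0, hd0⟩, true)]
    exact hitting_unitVec_lt_one hd hν _

/-- The factor `1 / u` makes `φ` equal to `1` on the whole ball, hence harmonic at the origin too.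
On the sphere one step gives `1 + (1 - 1 / u) / (2 * d)`, which is the eigenvalue. -/
theorem IsRandomWalk.tendsto_maxOccupationRatio_unitSphere (hX : IsRandomWalk X P)
    (hs : IsSimple X P) (hd : 3 ≤ d) :
    ∀ᵐ ω ∂P, Tendsto (maxOccupationRatio (fun n => X n ω) (unitSphere d)) atTop
      (𝓝 (-1 / Real.log (1 - noReturnProb X P / (2 * (d : ℝ) * (1 - noReturnProb X P))))) := by
  have := hX.isProbabilityMeasure
  have hν := hX.map_real_unitSphere hs
  have hd0 : 0 < d := by omega
  have hd' : (0 : ℝ) < d := by exact_mod_cast hd0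
  obtain ⟨hγ, hall, hlow, hlt⟩ := hX.one_sub_noReturnProb hs hd
  set ν := P.map (X 1)
  set u := 1 - noReturnProb X P with hu
  have hu0 : 0 < u := lt_of_lt_of_le (by positivity) hlow
  have hγu : noReturnProb X P = 1 - u := by rw [hu]; ring
  have hval : ∀ p, scaledHitting ν u⁻¹ (unitVec p) = 1 := fun p => by
    rw [scaledHitting_of_ne (unitVec_ne_zero p), hall, inv_mul_cancel₀ hu0.ne']
  have h2du : 1 ≤ 2 * d * u := by
    rwa [div_le_iff₀ (by positivity), mul_comm] at hlow
  rw [hγu]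
  refine hX.tendsto_maxOccupationRatio finite_unitSphere ⟨_, unitVec_mem (⟨0, hd0⟩, true)⟩
    (φ := scaledHitting ν u⁻¹) (C := max 1 u⁻¹) ?_ ?_ (scaledHitting_nonneg (inv_nonneg.2 hu0.le))
    (fun x => (scaledHitting_le _ x).trans (mul_hitting_le (max_one_nonneg _) x)) ?_ ?_ ?_
    (tendsto_killedIterate_unitSphere hd0 hν (inv_nonneg.2 hu0.le))
  · rw [sub_pos, div_lt_one (by positivity)]; linarith
  · have : 0 < (1 - u) / (2 * d * u) := div_pos (by linarith) (by positivity)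
    linarith
  · rw [← range_unitVec]
    rintro _ ⟨p, rfl⟩
    rw [hval]; exact one_pos
  · intro x hx
    rcases eq_or_ne x 0 with rfl | hx0
    · rw [transition_scaledHitting_zero hd0 hν, hγ, scaledHitting_zero, inv_mul_cancel₀ hu0.ne']
    · exact transition_scaledHitting_of_notMem hd0 hν _ hx0 hx
  · rw [← range_unitVec]
    rintro _ ⟨p, rfl⟩
    rw [hval, transition_scaledHitting_unitVec hd0 hν, hall]
    field_simp
    ring

/-- With `φ = 1` at the origin, the eigenvalue equation there forces `φ = r` on the sphere, i.e. the
factor `r / u`. The equation on the sphere is then `r ^ 2 = p * r + 1 / (2 * d)`, and `r` is its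
positive root. -/
theorem IsRandomWalk.tendsto_maxOccupationRatio_unitBall (hX : IsRandomWalk X P)
    (hs : IsSimple X P) (hd : 3 ≤ d) {p : ℝ}
    (hp : p = 1 - 1 / (2 * (d : ℝ) * (1 - noReturnProb X P))) :
    ∀ᵐ ω ∂P, Tendsto (maxOccupationRatio (fun n => X n ω) (unitBall d)) atTop
      (𝓝 (-1 / Real.log ((p + Real.sqrt (p ^ 2 + 2 / (d : ℝ))) / 2))) := by
  have := hX.isProbabilityMeasure
  have hν := hX.map_real_unitSphere hs
  have hd0 : 0 < d := by omega
  have hd' : (0 : ℝ) < d := by exact_mod_cast hd0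
  obtain ⟨hγ, hall, hlow, hlt⟩ := hX.one_sub_noReturnProb hs hd
  set ν := P.map (X 1)
  set u := 1 - noReturnProb X P
  have hu0 : 0 < u := lt_of_lt_of_le (by positivity) hlow
  have h2du : 1 ≤ 2 * d * u := by
    rwa [div_le_iff₀ (by positivity), mul_comm] at hlow
  have hp0 : 0 ≤ p := by
    rw [hp, sub_nonneg, div_le_one (by positivity)]; exact h2du
  -- Transience, `u < 1`, makes `t ^ 2 - p * t - 1 / (2 * d)` positive at `t = 1`; this puts the
  -- root `r` below `1`.
  have hp1 : p + 1 / (2 * d) < 1 := by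
    have : 1 / (2 * (d : ℝ)) < 1 / (2 * d * u) := by
      refine one_div_lt_one_div_of_lt (by positivity) ?_
      exact mul_lt_of_lt_one_right (by positivity) hlt
    linarith
  set r := (p + Real.sqrt (p ^ 2 + 2 / (d : ℝ))) / 2 with hr
  have hsq : Real.sqrt (p ^ 2 + 2 / (d : ℝ)) ^ 2 = p ^ 2 + 2 / (d : ℝ) :=
    Real.sq_sqrt (by positivity)
  have hsqrt0 : 0 < Real.sqrt (p ^ 2 + 2 / (d : ℝ)) := Real.sqrt_pos.2 (by positivity)
  have hr0 : 0 < r := by rw [hr]; linarith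
  have hr2 : r * r = r * p + 1 / (2 * d) := by
    have : 1 / (2 * (d : ℝ)) = (2 / d) / 4 := by ring
    rw [hr, this]; linarith
  have hr1 : r < 1 := by
    by_contra hcon
    rw [not_lt] at hcon
    have : 0 < 1 / (2 * (d : ℝ)) := by positivity
    nlinarith
  have hc0 : 0 ≤ r / u := (div_pos hr0 hu0).le
  have hval : ∀ q, scaledHitting ν (r / u) (unitVec q) = r := fun q => by
    rw [scaledHitting_of_ne (unitVec_ne_zero q), hall, div_mul_cancel₀ _ hu0.ne']
  refine hX.tendsto_maxOccupationRatio finite_unitBall ⟨0, Set.mem_insert _ _⟩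
    (φ := scaledHitting ν (r / u)) (C := max 1 (r / u)) hr0 hr1 (scaledHitting_nonneg hc0)
    (fun x => (scaledHitting_le _ x).trans (mul_hitting_le (max_one_nonneg _) x)) ?_ ?_ ?_
    (tendsto_killedIterate_unitBall hc0)
  · rw [unitBall, ← range_unitVec]
    rintro _ (rfl | ⟨q, rfl⟩)
    · rw [scaledHitting_zero]; exact one_pos
    · rw [hval]; exact hr0
  · intro x hx
    rw [unitBall, Set.mem_insert_iff, not_or] at hx
    exact transition_scaledHitting_of_notMem hd0 hν _ hx.1 hx.2
  · rw [unitBall, ← range_unitVec]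
    rintro _ (rfl | ⟨q, rfl⟩)
    · rw [transition_scaledHitting_zero hd0 hν, hγ, scaledHitting_zero,
        div_mul_cancel₀ _ hu0.ne', mul_one]
    · rw [hval, transition_scaledHitting_unitVec hd0 hν, hall, hr2, hp]
      field_simp
      ring

end SimpleOccupation

end LatticeWalk

open LatticeWalk
theorem theorem1p2 {d : ℕ} (hd : 3 ≤ d) {Ω : Type*} [MeasurableSpace Ω] (P : Measure Ω)
    [IsProbabilityMeasure P] (X : ℕ → Ω → (Fin d → ℤ)) (hX : IsRandomWalk X P) :
    (IsSymmetric X P → IsTransient X P → IsFull X P → HasSecondMoments X P →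
      ∀ y : Fin d → ℤ, y ≠ 0 →
        ∀ᵐ ω ∂P, Tendsto (maxOccupationRatio (fun n => X n ω) {0, y}) atTop
          (𝓝 (-1 / Real.log (1 - noReturnProb X P / (1 + hitProb X P y))))) ∧
    (IsSimple X P →
      (∀ᵐ ω ∂P, Tendsto (maxOccupationRatio (fun n => X n ω) (unitSphere d)) atTop
        (𝓝 (-1 / Real.log
          (1 - noReturnProb X P / (2 * (d : ℝ) * (1 - noReturnProb X P)))))) ∧
      (∀ p : ℝ, p = 1 - 1 / (2 * (d : ℝ) * (1 - noReturnProb X P)) →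
        ∀ᵐ ω ∂P, Tendsto (maxOccupationRatio (fun n => X n ω) (unitBall d)) atTop
          (𝓝 (-1 / Real.log ((p + Real.sqrt (p ^ 2 + 2 / (d : ℝ))) / 2))))) :=
  ⟨fun hsymm htrans _ _ _ hy => hX.tendsto_maxOccupationRatio_pair hsymm htrans hy,
    fun hs => ⟨hX.tendsto_maxOccupationRatio_unitSphere hs hd,
      fun _ hp => hX.tendsto_maxOccupationRatio_unitBall hs hd hp⟩⟩
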